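/- **Setting.** Let $R,S\in(0,\infty)\setminus\{1\}$, $\delta,r,\mu\in\mathbb R$, $\sigma>0$, and put $\lambda=\frac{\mu-r}{\sigma}$, $\alpha=\delta-r(1-S)$, $q_M=\frac{\lambda}{\sigma R}$, $$m(q)=\tfrac{\alpha}{S}-\tfrac{1-S}{S}\lambda\sigma q+R\tfrac{1-S}{S}\tfrac{\sigma^2}{2}q^2,\qquad \ell(q)=\tfrac{\alpha}{S}-\tfrac{1-S}{S}\big(\lambda\sigma-\tfrac{\sigma^2}{2}\big)q-(1-R)\tfrac{1-S}{S}\tfrac{\sigma^2}{2}q^2,$$ $\hat m=m(q_M)$, $\Delta=\frac{3q_M^2(1-q_M)^2}{4R}$, $h_3(v)=(1+v)^2(2-v)$ and $\tau_c(q)=\frac{cq}{1+(c-1)q}$. An Epstein–Zin agent (risk aversion $R$, elasticity of intertemporal complementarity $S$, discount parameter $\delta$) trades a bond with rate $r$ and a stock with drift $\mu$ and volatility $\sigma$; buying a share costs $\gamma^\uparrow y$ and selling it yields $y/\gamma^\downarrow$ when the stock price is $y$. For $\gamma^\uparrow,\gamma^\downarrow\ge 1$ with $\xi=\gamma^\uparrow\gamma^\downarrow>1$,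 the optimal behaviour is described by the following data. * Free boundaries $q_*<q^*$ with: $0<q_*<q_M<q^*<1$ if $q_M\in(0,1)$; $0<q_*<q^*=1$ if $q_M=1$; $0<q_*<q_M<q^*<2q_M-1$ if $q_M>1$; $2q_M<q_*<q_M<q^*<0$ if $q_M<0$. Further, a $C^1$ function $n:[q_*,q^*]\to(0,\infty)$, decreasing if $(1-R)q_M>0$ and increasing if $(1-R)q_M<0$, with $n\ne\ell$ and $n'=\frac{1-S}{S}\frac{n}{1-q}\frac{m-n}{\ell-n}$ off $q=1$, $n=m$ and $n'=0$ at $q_*$ and $q^*$, $n(1)=m(1)$ and $n'(1)=m'(1)$ if $1\in[q_*,q^*]$, and $\xi=\exp\big(\int_{q_*}^{q^*}-\frac{1}{q(1-q)}\frac{m-n}{\ell-n}\,dq\big)$. * A decreasing $C^1$ function $\kappa:[q_*,q^*]\to(0,\infty)$ with $\kappa'=\frac{\kappa}{q(1-q)}\frac{m-n}{\ell-n}$ off $q=1$, $\kappa(q_*)=\gamma^\uparrow$, $\kappa(q^*)=1/\gamma^\downarrow$, $\kappa'(q_*)=\kappa'(q^*)=0$. * With $p_*=\tau_{1/\gamma^\uparrow}(q_*)<p^*=\tau_{\gamma^\downarrow}(q^*)$,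 an increasing $C^1$ function $q(\cdot):[p_*,p^*]\to[q_*,q^*]$ with $q'(p)=\frac{\ell(q(p))-n(q(p))}{\ell(p)-m(p)}$ off $p=1$, $q(p_*)=q_*$, $q(p^*)=q^*$, $q'(p_*)=\tau_{\gamma^\uparrow}'(p_*)$, $q'(p^*)=\tau_{1/\gamma^\downarrow}'(p^*)$, and $q(1)=1$ if $1\in[p_*,p^*]$. Let $(x,y,\phi)$ (cash, stock price, number of shares) lie in the interior of the solvency region, i.e. $y>0$ and $x+\frac1{\gamma^\downarrow}\phi^+y-\gamma^\uparrow\phi^-y>0$, and let $p=\frac{y\phi}{x+y\phi}$ lie in the no-transaction region $[p_*,p^*]$. The optimal consumption, in feedback form, is $$C^*_{\gamma^\uparrow,\gamma^\downarrow}(t,x,y,\phi)=\big(x+\phi y\,\kappa(q(p))\big)\,n(q(p)),$$ and the optimal consumption without transaction costs is $C^*_{1,1}(t,x,y,\phi)=(x+y\phi)\hat m$. **Proposition.** Suppose that either $R,S<1$ and $\hat m\ge0$, or $R,S>1$ and $\hat m>0$, and that $q_M\notin\{0,1\}$. There are $\epsilon_0>0$ and $K$, depending only on $R,S,\delta,r,\mu,\sigma$,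 such that for all $\epsilon^\uparrow,\epsilon^\downarrow\in(0,\epsilon_0)$, with $\gamma^\uparrow=1+\epsilon^\uparrow$, $\gamma^\downarrow=1+\epsilon^\downarrow$ and $\epsilon=\gamma^\uparrow\gamma^\downarrow-1$, data as above exist and, for all such data, all $t\ge0$ and all $(x,y,\phi)$ in the interior of the solvency region with $p\in[p_*,p^*]$, the following holds. If $\hat m>0$, $$C^*_{1+\epsilon^\uparrow,1+\epsilon^\downarrow}(t,x,y,\phi)=C^*_{1,1}(t,x,y,\phi)\Big(1+\tfrac{R(1-S)}{S}\tfrac{\sigma^2}{2\hat m}\Delta^{2/3}(\epsilon^\uparrow+\epsilon^\downarrow)^{2/3}+\tfrac{q_M}{2S}\Big(1-\tfrac12h_3\Big(\tfrac{p-q_M}{\Delta^{1/3}\epsilon^{1/3}}\Big)\Big)(\epsilon^\uparrow+\epsilon^\downarrow)+\tfrac{q_M}{2}(\epsilon^\uparrow-\epsilon^\downarrow)\Big)+E,$$ and if $\hat m=0$, $$C^*_{1+\epsilon^\uparrow,1+\epsilon^\downarrow}(t,x,y,\phi)=(x+y\phi)\,\tfrac{R(1-S)}{S}\tfrac{\sigma^2}{2}\Delta^{2/3}(\epsilon^\uparrow+\epsilon^\downarrow)^{2/3}+E,$$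 where in both cases $|E|\le K\,(x+y\phi)\,\epsilon^{4/3}$. -/

import Mathlib

open Set

namespace EpsteinZin

/-- Parameters of the Black-Scholes-Merton market (interest rate `r`, drift `μ`, volatility `σ`) and
of the Epstein-Zin agent (risk aversion `R`, elasticity of intertemporal complementarity `S`,
discount parameter `δ`). -/
structure Params where
  R : ℝ
  S : ℝ
  δ : ℝ
  r : ℝ
  μ : ℝ
  σ : ℝ

noncomputable section

/-- Market price of risk. -/
def Params.lam (P : Params) : ℝ := (P.μ - P.r) / P.σ

/-- Effective impatience rate. -/
def Params.alpha (P : Params) : ℝ := P.δ - P.r * (1 - P.S)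

/-- Frictionless optimal consumption rate per unit of wealth when the constant fraction `q` of wealth
is held in the risky asset. -/
def Params.m (P : Params) (q : ℝ) : ℝ :=
  P.alpha / P.S - (1 - P.S) / P.S * P.lam * P.σ * q
    + P.R * ((1 - P.S) / P.S) * (P.σ ^ 2 / 2) * q ^ 2

def Params.ell (P : Params) (q : ℝ) : ℝ :=
  P.alpha / P.S - (1 - P.S) / P.S * (P.lam * P.σ - P.σ ^ 2 / 2) * q
    - (1 - P.R) * ((1 - P.S) / P.S) * (P.σ ^ 2 / 2) * q ^ 2

/-- Merton ratio. -/
def Params.qM (P : Params) : ℝ := P.lam / (P.σ * P.R)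

/-- Frictionless optimal consumption rate. -/
def Params.mM (P : Params) : ℝ := P.m P.qM

def Params.Delta (P : Params) : ℝ := 3 * P.qM ^ 2 * (1 - P.qM) ^ 2 / (4 * P.R)

def h3 (v : ℝ) : ℝ := (1 + v) ^ 2 * (2 - v)

/-- The real Möbius transformation `τ_c`, away from its pole. -/
def mobius (c q : ℝ) : ℝ := c * q / (1 + (c - 1) * q)

/-- `n : [a, b] → (0, ∞)` solves the first-order free boundary problem for the round-trip
transaction cost `ξ`, with free boundaries `a = q_*(ξ)` and `b = q^*(ξ)`. -/
structure FreeBoundary (P : Params) (ξ a b : ℝ) (n : ℝ → ℝ) : Prop where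
  loc_mid : 0 < P.qM → P.qM < 1 → 0 < a ∧ a < P.qM ∧ P.qM < b ∧ b < 1
  loc_one : P.qM = 1 → 0 < a ∧ a < b ∧ b = 1
  loc_big : 1 < P.qM → 0 < a ∧ a < P.qM ∧ P.qM < b ∧ b < 2 * P.qM - 1
  loc_neg : P.qM < 0 → 2 * P.qM < a ∧ a < P.qM ∧ P.qM < b ∧ b < 0
  contDiff : ContDiffOn ℝ 1 n (Icc a b)
  pos : ∀ q ∈ Icc a b, 0 < n q
  ne_ell : ∀ q ∈ Icc a b, q ≠ 1 → n q ≠ P.ell q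
  /-- `n` is monotone; it is decreasing exactly when `1 - R` and the Merton ratio have the same
  sign. -/
  anti : 0 < (1 - P.R) * P.qM → AntitoneOn n (Icc a b)
  mono : (1 - P.R) * P.qM < 0 → MonotoneOn n (Icc a b)
  ode : ∀ q ∈ Icc a b, q ≠ 1 →
    derivWithin n (Icc a b) q
      = (1 - P.S) / P.S * (n q / (1 - q)) * ((P.m q - n q) / (P.ell q - n q))
  bd_left : n a = P.m a
  bd_right : n b = P.m b
  deriv_left : derivWithin n (Icc a b) a = 0
  deriv_right : derivWithin n (Icc a b) b = 0
  at_one : 1 ∈ Icc a b → n 1 = P.m 1 ∧ derivWithin n (Icc a b) 1 = deriv P.m 1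
  integral_eq : ξ = Real.exp
    (∫ q in a..b, -(1 / (q * (1 - q))) * ((P.m q - n q) / (P.ell q - n q)))

/-- `κ : [a, b] → (0, ∞)` is the relative shadow price associated with `n`. -/
structure RelShadowPrice (P : Params) (γu γd a b : ℝ) (n κ : ℝ → ℝ) : Prop where
  contDiff : ContDiffOn ℝ 1 κ (Icc a b)
  pos : ∀ q ∈ Icc a b, 0 < κ q
  anti : AntitoneOn κ (Icc a b)
  ode : ∀ q ∈ Icc a b, q ≠ 1 →
    derivWithin κ (Icc a b) q
      = κ q / (q * (1 - q)) * ((P.m q - n q) / (P.ell q - n q))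
  bd_left : κ a = γu
  bd_right : κ b = 1 / γd
  deriv_left : derivWithin κ (Icc a b) a = 0
  deriv_right : derivWithin κ (Icc a b) b = 0

/-- `sf : [p_*, p^*] → [a, b]` expresses the shadow fraction of wealth in terms of the fraction of
wealth invested in the risky asset. -/
structure ShadowFraction (P : Params) (γu γd a b pLow pHigh : ℝ) (n sf : ℝ → ℝ) : Prop where
  contDiff : ContDiffOn ℝ 1 sf (Icc pLow pHigh)
  mapsTo : MapsTo sf (Icc pLow pHigh) (Icc a b)
  mono : MonotoneOn sf (Icc pLow pHigh)
  ode : ∀ p ∈ Icc pLow pHigh, p ≠ 1 →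
    derivWithin sf (Icc pLow pHigh) p = (P.ell (sf p) - n (sf p)) / (P.ell p - P.m p)
  bd_left : sf pLow = a
  bd_right : sf pHigh = b
  deriv_left : derivWithin sf (Icc pLow pHigh) pLow = deriv (mobius γu) pLow
  deriv_right : derivWithin sf (Icc pLow pHigh) pHigh = deriv (mobius (1 / γd)) pHigh
  at_one : 1 ∈ Icc pLow pHigh → sf 1 = 1

/-- The data describing the optimal behaviour: the shadow no-transaction region `[qLow, qHigh]`, the
consumption rate `n` per unit of shadow wealth, the relative shadow price `κ`, and the shadow fraction
of wealth `sf` as a function of the real fraction of wealth. -/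
structure ShadowData where
  qLow : ℝ
  qHigh : ℝ
  n : ℝ → ℝ
  κ : ℝ → ℝ
  sf : ℝ → ℝ

/-- Lower boundary `p_*` of the real no-transaction region. -/
def ShadowData.pLow (D : ShadowData) (γu : ℝ) : ℝ := mobius (1 / γu) D.qLow

/-- Upper boundary `p^*` of the real no-transaction region. -/
def ShadowData.pHigh (D : ShadowData) (γd : ℝ) : ℝ := mobius γd D.qHigh

/-- `D` is the shadow data of the problem with transaction cost parameters `γu`, `γd`. -/
structure ShadowData.Solves (D : ShadowData) (P : Params) (γu γd : ℝ) : Prop where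
  lt : D.pLow γu < D.pHigh γd
  free_boundary : FreeBoundary P (γu * γd) D.qLow D.qHigh D.n
  shadow_price : RelShadowPrice P γu γd D.qLow D.qHigh D.n D.κ
  shadow_fraction :
    ShadowFraction P γu γd D.qLow D.qHigh (D.pLow γu) (D.pHigh γd) D.n D.sf

/-- Interior of the solvency region: `x` is the cash position, `y` the price of the risky asset and
`φ` the number of shares. -/
def Solvent (γu γd x y φ : ℝ) : Prop :=
  0 < y ∧ 0 < x + 1 / γd * max φ 0 * y - γu * max (-φ) 0 * y

/-- Fraction of wealth invested in the risky asset. -/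
def frac (x y φ : ℝ) : ℝ := y * φ / (x + y * φ)

/-- Optimal consumption in feedback form on the no-transaction region: shadow wealth times the
consumption rate per unit of shadow wealth. It does not depend on time. -/
def ShadowData.consumption (D : ShadowData) (_t x y φ : ℝ) : ℝ :=
  (x + φ * y * D.κ (D.sf (frac x y φ))) * D.n (D.sf (frac x y φ))

/-- Optimal consumption without transaction costs. -/
def Params.consumption0 (P : Params) (_t x y φ : ℝ) : ℝ := (x + y * φ) * P.mM

end

end EpsteinZin

/-! ### Reduction to a regular system for the scaled excess and the log shadow price -/

namespace EpsteinZin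

open Filter Topology Asymptotics

/-! Put `g = (n - m) / gap`, let `I` be the decrease of `log κ` from the left free boundary, and `G
= I'`. Since `ell - m = gap * q * (1 - q)`, the equations for `n` and `κ` become `g' = -2R(q - qM) -
(2/σ²) n q G` and `q(1-q)(q(1-q) - g) G = g`, with `g = 0` at both ends and total increase `L = log
ξ` of `I`. So `g` is nearly the parabola `R(u² - (q - qM)²)`, where `u = qM - a`, and `I'` is nearly
`g / A0²` with `A0 = qM(1 - qM)`. An interval of half-width `D` therefore accounts for a cost `L ≈
4R D³ / (3 A0²) = D³ / Δ`, which is the source of the cube root scale `h = ε^(1/3)`.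

To make this uniform over all solutions, a crude comparison (`Reduced.exists_cube_le`) first puts
the free boundaries within `O(h)` of `qM`. Then each integration over the interval gains one power
of `h`, and the expansions of `g`, `G` and `I` are refined in turn. At the right boundary they give
the asymmetry of the interval and the half-width `D = δ₀ h + O(h³)`; the potential `h²` correction
to `D` disappears through an exact cancellation (`Pt.O_L_sub_cube`). The result is `n = mM + gap R
(δ₀h)² + gap B (h³/2 - I) + O(h⁴)` (`Pt.O_rate`). The real and shadow fractions differ by `O(h²)`,
so `I = h³ h3(v) / 4 + O(h⁴)` in terms of the real position `v` (`Obs.O_I_sub`). Multiplying `n` by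
the shadow wealth per unit of wealth, `1 + p(κ - 1)` with `κ = (1 + εu) exp(-I)`, gives the claim
(`Obs.O_ratio`).

For existence, the reduced equation is a smooth scalar equation near `(qM, 0)` whose solutions are
unimodal up to an integrating factor. Starting from a small height `z > 0` at `qM`, the solution
makes a positive excursion. The cost of the excursion depends continuously on `z` and vanishes at `z
= 0`, so it takes every small value (`exists_excursion`). Then `κ` is the exponential of `-∫ G`,
scaled to equal `γu` at the left boundary, and the shadow fraction is the inverse of `q ↦ q / (κ +
(1 - κ) q)` (`exists_solves`). -/

/-- The coefficient in `ell q - m q = gap * q * (1 - q)`. -/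
noncomputable def Params.gap (P : Params) : ℝ := (1 - P.S) / P.S * (P.σ ^ 2 / 2)

/-- The standing assumptions on the parameters. -/
structure Params.Regular (P : Params) : Prop where
  σ_pos : 0 < P.σ
  R_pos : 0 < P.R
  S_pos : 0 < P.S
  R_ne_one : P.R ≠ 1
  gap_ne : P.gap ≠ 0
  qM_ne_zero : P.qM ≠ 0
  qM_ne_one : P.qM ≠ 1

theorem Params.ell_sub_m (P : Params) (q : ℝ) : P.ell q - P.m q = P.gap * (q * (1 - q)) := by
  simp only [Params.ell, Params.m, Params.gap]; ring

theorem Params.m_eq {P : Params} (hσ : P.σ ≠ 0) (hR : P.R ≠ 0) (q : ℝ) :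
    P.m q = P.mM + P.gap * P.R * (q - P.qM) ^ 2 := by
  have hl : P.lam = P.σ * P.R * P.qM := by
    simp only [Params.qM]; field_simp
  simp only [Params.mM, Params.m, Params.gap, hl]
  ring

/-- Consumption rate in terms of the scaled excess `g = (n - m) / gap`. -/
noncomputable def Params.rate (P : Params) (g : ℝ → ℝ) (q : ℝ) : ℝ :=
  P.mM + P.gap * (P.R * (q - P.qM) ^ 2 + g q)

/-- An upper bound for the consumption rate. -/
noncomputable def Params.rateBound (P : Params) : ℝ :=
  |P.mM| + |P.gap| * P.R * (3 * |P.qM| + 1) ^ 2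

/-- The free boundary problem in terms of the scaled excess `g = (n - m) / gap` and of the decrease
`I` of the logarithm of the relative shadow price, whose derivative is `G`. -/
structure Reduced (P : Params) (L a b : ℝ) (g I G : ℝ → ℝ) : Prop where
  left_lt : a < P.qM
  lt_right : P.qM < b
  abs_q_le : ∀ q ∈ Icc a b, |q| ≤ 2 * |P.qM| + 1
  g_left : g a = 0
  g_right : g b = 0
  I_left : I a = 0
  I_right : I b = L
  deriv_I : ∀ q ∈ Icc a b, HasDerivWithinAt I (G q) (Icc a b) q
  deriv_g : ∀ q ∈ Icc a b, HasDerivWithinAt g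
    (-(2 * P.R * (q - P.qM)) - 2 / P.σ ^ 2 * (P.rate g q * q * G q)) (Icc a b) q
  g_nonneg : ∀ q ∈ Icc a b, 0 ≤ g q
  G_nonneg : ∀ q ∈ Icc a b, 0 ≤ G q
  mul_G : ∀ q ∈ Icc a b, q * (1 - q) * (q * (1 - q) - g q) * G q = g q
  weight_nonneg : ∀ q ∈ Icc a b, 0 ≤ q * (1 - q) * (q * (1 - q) - g q)
  rate_le : ∀ q ∈ Icc a b, |P.rate g q| ≤ P.rateBound

namespace Reduced

variable {P : Params} {L a b : ℝ} {g I G : ℝ → ℝ}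

theorem lt (h : Reduced P L a b g I G) : a < b := h.left_lt.trans h.lt_right

theorem left_mem (h : Reduced P L a b g I G) : a ∈ Icc a b := left_mem_Icc.2 h.lt.le

theorem right_mem (h : Reduced P L a b g I G) : b ∈ Icc a b := right_mem_Icc.2 h.lt.le

end Reduced

/-! ### A priori bounds on the free boundaries -/

theorem monotoneOn_Icc_of_hasDerivWithinAt {f f' : ℝ → ℝ} {a b : ℝ}
    (hf : ∀ x ∈ Icc a b, HasDerivWithinAt f (f' x) (Icc a b) x)
    (h : ∀ x ∈ Icc a b, 0 ≤ f' x) : MonotoneOn f (Icc a b) := by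
  refine monotoneOn_of_hasDerivWithinAt_nonneg (convex_Icc a b)
    (fun x hx => (hf x hx).continuousWithinAt) (f' := f') (fun x hx => ?_) (fun x hx => ?_)
  · exact (hf x (interior_subset hx)).mono interior_subset
  · exact h x (interior_subset hx)

namespace Reduced

variable {P : Params} {L a b : ℝ} {g I G : ℝ → ℝ}

theorem I_mono (h : Reduced P L a b g I G) : MonotoneOn I (Icc a b) :=
  monotoneOn_Icc_of_hasDerivWithinAt h.deriv_I h.G_nonneg

theorem I_nonneg (h : Reduced P L a b g I G) {q : ℝ} (hq : q ∈ Icc a b) : 0 ≤ I q := by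
  have := h.I_mono h.left_mem hq hq.1
  rwa [h.I_left] at this

theorem I_le (h : Reduced P L a b g I G) {q : ℝ} (hq : q ∈ Icc a b) : I q ≤ L := by
  have := h.I_mono hq h.right_mem hq.2
  rwa [h.I_right] at this

end Reduced

/-- Bounds the deviation of the excess from a parabola. -/
noncomputable def Params.devBound (P : Params) : ℝ :=
  2 / P.σ ^ 2 * (P.rateBound * (2 * |P.qM| + 1))

theorem Params.rateBound_nonneg {P : Params} (hR : 0 < P.R) : 0 ≤ P.rateBound := by
  unfold Params.rateBound; positivity

theorem Params.devBound_nonneg {P : Params} (hR : 0 < P.R) : 0 ≤ P.devBound := by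
  have := Params.rateBound_nonneg hR
  unfold Params.devBound; positivity

namespace Reduced

variable {P : Params} {L a b : ℝ} {g I G : ℝ → ℝ}

/-- Up to sign, the term of `g'` besides that of the parabola is `(2/σ²) n q G`, which is at most
`devBound * G = devBound * I'` in absolute value. So `devBound * I ± (g + R (q - qM)²)` are both
increasing, and comparison with the left end, where `g = I = 0`, gives the bound. -/
theorem abs_g_sub_le (hR : 0 < P.R) (h : Reduced P L a b g I G) {q : ℝ} (hq : q ∈ Icc a b) :
    |g q - P.R * ((P.qM - a) ^ 2 - (q - P.qM) ^ 2)| ≤ P.devBound * I q := by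
  have key : ∀ s : ℝ, |s| = 1 → MonotoneOn (fun q => P.devBound * I q
      + s * (g q + P.R * (q - P.qM) ^ 2)) (Icc a b) := by
    intro s hs
    refine monotoneOn_Icc_of_hasDerivWithinAt (f' := fun q => P.devBound * G q
      - s * (2 / P.σ ^ 2 * (P.rate g q * q * G q))) (fun x hx => ?_) (fun x hx => ?_)
    · have h1 : HasDerivWithinAt (fun q : ℝ => P.R * (q - P.qM) ^ 2) (2 * P.R * (x - P.qM))
          (Icc a b) x := by
        have := (((hasDerivAt_id x).sub_const P.qM).pow 2).const_mul P.R
        refine HasDerivAt.hasDerivWithinAt (this.congr_deriv ?_)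
        simp; ring
      refine (((h.deriv_I x hx).const_mul P.devBound).add
        (((h.deriv_g x hx).add h1).const_mul s)).congr_deriv ?_
      ring
    · have h1 : s * (2 / P.σ ^ 2 * (P.rate g x * x * G x)) ≤ P.devBound * G x := by
        refine (le_abs_self _).trans ?_
        rw [abs_mul, hs, one_mul, abs_mul, abs_mul, abs_mul, abs_of_nonneg (h.G_nonneg x hx),
          abs_of_nonneg (by positivity : 0 ≤ 2 / P.σ ^ 2), Params.devBound, mul_assoc (2 / P.σ ^ 2)]
        have h2 := h.rate_le x hx
        have h3 := h.abs_q_le x hx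
        have h4 := h.G_nonneg x hx
        have h5 := Params.rateBound_nonneg hR
        gcongr
      simpa using h1
  have h1 := key 1 (by simp) h.left_mem hq hq.1
  have h2 := key (-1) (by simp) h.left_mem hq hq.1
  simp only [h.I_left, h.g_left] at h1 h2
  rw [abs_le]
  constructor <;> linarith [show (a - P.qM) ^ 2 = (P.qM - a) ^ 2 by ring]

/-- Global bound: the cubes of the distances of the free boundaries from the Merton ratio are
controlled by the logarithm of the round trip cost. -/
theorem exists_cube_le (hR : 0 < P.R) : ∃ C : ℝ, ∀ {L a b : ℝ} {g I G : ℝ → ℝ},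
    Reduced P L a b g I G → L ≤ 1 → (P.qM - a) ^ 3 + (b - P.qM) ^ 3 ≤ C * L := by
  set Q : ℝ := 3 * |P.qM| + 1 with hQ
  have hQ1 : 1 ≤ Q := by have := abs_nonneg P.qM; linarith
  set C₁ := P.devBound with hC₁
  have hC₁0 : 0 ≤ C₁ := Params.devBound_nonneg hR
  -- `M` dominates the weight `q(1-q)(q(1-q) - g)`, by `|q| ≤ Q` and `g ≤ R Q² + C₁`; hence `g ≤ M
  -- G`.
  set M : ℝ := (Q * (1 + Q)) * (Q * (1 + Q) + (P.R * Q ^ 2 + C₁)) with hM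
  have hM0 : 0 < M := by positivity
  refine ⟨(M + 3 * C₁ * Q) / (2 / 3 * P.R), fun {L a b g I G} h hL => ?_⟩
  have hL0 : 0 ≤ L := by
    have := h.I_nonneg h.right_mem
    rwa [h.I_right] at this
  have hda : 0 < P.qM - a := sub_pos.2 h.left_lt
  have hdb : 0 < b - P.qM := sub_pos.2 h.lt_right
  have hqQ : ∀ q ∈ Icc a b, |q| ≤ Q := fun q hq => by
    have := h.abs_q_le q hq; have := abs_nonneg P.qM; linarith
  have hsQ : ∀ q ∈ Icc a b, |q - P.qM| ≤ Q := fun q hq => by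
    have h1 := h.abs_q_le q hq
    have h2 := abs_sub q P.qM
    linarith
  have hdaQ : P.qM - a ≤ Q := by
    have := (abs_le.1 (hsQ a h.left_mem)).1; linarith
  have hdbQ : b - P.qM ≤ Q := (abs_le.1 (hsQ b h.right_mem)).2
  have hdev : ∀ q ∈ Icc a b, |g q - P.R * ((P.qM - a) ^ 2 - (q - P.qM) ^ 2)| ≤ C₁ * L :=
    fun q hq => (h.abs_g_sub_le hR hq).trans (mul_le_mul_of_nonneg_left (h.I_le hq) hC₁0)
  have hgmax : ∀ q ∈ Icc a b, g q ≤ P.R * Q ^ 2 + C₁ := fun q hq => by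
    have h1 := (abs_le.1 (hdev q hq)).2
    have h2 : P.R * ((P.qM - a) ^ 2 - (q - P.qM) ^ 2) ≤ P.R * Q ^ 2 := by
      have : (P.qM - a) ^ 2 ≤ Q ^ 2 := by gcongr
      have := sq_nonneg (q - P.qM)
      gcongr; linarith
    nlinarith
  have hAbs : ∀ q ∈ Icc a b, |q * (1 - q)| ≤ Q * (1 + Q) := fun q hq => by
    have h1 := hqQ q hq
    have h2 : |1 - q| ≤ 1 + Q := by
      have := abs_sub (1 : ℝ) q
      rw [abs_one] at this; linarith
    rw [abs_mul]; gcongr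
  have hgG : ∀ q ∈ Icc a b, g q ≤ M * G q := fun q hq => by
    have h1 : q * (1 - q) * (q * (1 - q) - g q) ≤ M := by
      refine (le_abs_self _).trans ?_
      rw [abs_mul, hM]
      have h2 := hAbs q hq
      have h3 : |q * (1 - q) - g q| ≤ Q * (1 + Q) + (P.R * Q ^ 2 + C₁) := by
        have := abs_sub (q * (1 - q)) (g q)
        rw [abs_of_nonneg (h.g_nonneg q hq)] at this
        linarith [hgmax q hq]
      gcongr
    rw [← h.mul_G q hq]
    exact mul_le_mul_of_nonneg_right h1 (h.G_nonneg q hq)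
  -- comparison of `M * I` with the integral of the parabola
  have hmono : MonotoneOn (fun q => M * I q - P.R * ((P.qM - a) ^ 2 * (q - P.qM)
      - (q - P.qM) ^ 3 / 3) + C₁ * L * q) (Icc a b) := by
    refine monotoneOn_Icc_of_hasDerivWithinAt (f' := fun q => M * G q
      - P.R * ((P.qM - a) ^ 2 - (q - P.qM) ^ 2) + C₁ * L) (fun x hx => ?_) (fun x hx => ?_)
    · have h0 := (hasDerivAt_id x).sub_const P.qM
      have h1 := ((h0.const_mul ((P.qM - a) ^ 2)).sub ((h0.pow 3).div_const 3)).const_mul P.R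
      refine ((((h.deriv_I x hx).const_mul M).sub h1.hasDerivWithinAt).add
        (((hasDerivAt_id x).const_mul (C₁ * L)).hasDerivWithinAt)).congr_deriv ?_
      simp
    · have h1 := (abs_le.1 (hdev x hx)).1
      have h2 := hgG x hx
      linarith
  have h1 := hmono h.left_mem h.right_mem h.lt.le
  simp only [h.I_left, h.I_right] at h1
  have h2 := (abs_le.1 (hdev b h.right_mem)).2
  have h2' := (abs_le.1 (hdev b h.right_mem)).1
  rw [h.g_right] at h2 h2'
  set u := P.qM - a with hu
  set v := b - P.qM with hv
  have h3 : a - P.qM = -u := by rw [hu]; ring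
  rw [h3] at h1
  have h4 : C₁ * L * b - C₁ * L * a ≤ C₁ * L * (2 * Q) := by
    have h5 : b - a ≤ 2 * Q := by
      have : b - a = u + v := by rw [hu, hv]; ring
      linarith
    have := mul_le_mul_of_nonneg_left h5 (mul_nonneg hC₁0 hL0)
    linarith
  -- The integrated comparison bounds `R (u² v - v³/3 + 2u³/3)`, and `u` and `v` are not yet known
  -- to be comparable. Since `g b = 0` forces `R (v² - u²) ≤ C₁ L`, adding `v` times this turns the
  -- mixed term into `v³`.
  have h5 : (P.R * (v ^ 2 - u ^ 2)) * v ≤ C₁ * L * Q := by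
    have h6 : P.R * (v ^ 2 - u ^ 2) ≤ C₁ * L := by linarith
    calc (P.R * (v ^ 2 - u ^ 2)) * v ≤ C₁ * L * v := by gcongr
      _ ≤ C₁ * L * Q := by gcongr
  have h6 : 2 / 3 * P.R * (u ^ 3 + v ^ 3) ≤ (M + 3 * C₁ * Q) * L := by nlinarith
  rw [div_mul_eq_mul_div, le_div_iff₀ (by positivity)]
  linarith

end Reduced

/-! ### Order symbols uniform over families of solutions -/

/-- `f` is of the order `h ^ n` as the size `h` tends to zero. -/
def IsO {X : Type*} (h : X → ℝ) (n : ℕ) (f : X → ℝ) : Prop :=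
  f =O[comap h (𝓝 0)] fun x => h x ^ n

namespace IsO

variable {X : Type*} {h : X → ℝ} {n k : ℕ} {f g : X → ℝ}

theorem tendsto (h : X → ℝ) : Tendsto h (comap h (𝓝 0)) (𝓝 0) := tendsto_comap

theorem add (hf : IsO h n f) (hg : IsO h n g) : IsO h n (fun x => f x + g x) :=
  IsBigO.add hf hg

theorem sub (hf : IsO h n f) (hg : IsO h n g) : IsO h n (fun x => f x - g x) :=
  IsBigO.sub hf hg

theorem mul (hf : IsO h n f) (hg : IsO h k g) : IsO h (n + k) (fun x => f x * g x) := by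
  simpa only [IsO, pow_add] using IsBigO.mul hf hg

theorem pow (hf : IsO h n f) (k : ℕ) : IsO h (n * k) (fun x => f x ^ k) := by
  simpa only [IsO, pow_mul] using IsBigO.pow hf k

theorem const_mul (c : ℝ) (hf : IsO h n f) : IsO h n (fun x => c * f x) :=
  IsBigO.const_mul_left hf c

theorem const (c : ℝ) : IsO h 0 (fun _ => c) := by
  simpa only [IsO, pow_zero] using isBigO_const_const c one_ne_zero _

theorem self : IsO h 1 h := by
  simpa only [IsO, pow_one] using isBigO_refl h _

theorem self_pow (n : ℕ) : IsO h n (fun x => h x ^ n) := isBigO_refl _ _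

theorem of_eq (hf : IsO h n f) (e : ∀ x, g x = f x) : IsO h n g := by
  rwa [show g = f from funext e]

theorem mono (hf : IsO h n f) (hk : k ≤ n) : IsO h k f := by
  refine IsBigO.trans hf ?_
  obtain ⟨j, rfl⟩ := Nat.exists_eq_add_of_le hk
  refine IsBigO.of_bound 1 ?_
  have : ∀ᶠ x in comap h (𝓝 0), |h x| < 1 := by
    have := (tendsto h).abs
    rw [abs_zero] at this
    exact this.eventually (gt_mem_nhds one_pos)
  filter_upwards [this] with x hx
  rw [pow_add, norm_mul, norm_pow, norm_pow, one_mul, Real.norm_eq_abs]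
  exact mul_le_of_le_one_right (by positivity) (pow_le_one₀ (abs_nonneg _) hx.le)

theorem of_abs_le (hg : IsO h n g) (C : ℝ)
    (H : ∀ᶠ x in comap h (𝓝 0), |f x| ≤ C * |g x|) : IsO h n f :=
  IsBigO.trans (IsBigO.of_bound C H) hg

theorem of_pow {j : ℕ} (hj : j ≠ 0) (hf : IsO h (n * j) (fun x => f x ^ j)) : IsO h n f := by
  have h2 : (fun x => f x ^ j) =O[comap h (𝓝 0)] fun x => (h x ^ n) ^ j := by
    simpa only [IsO, pow_mul] using hf
  exact IsBigO.of_pow hj h2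

theorem tendsto_zero (hf : IsO h n f) (hn : n ≠ 0) : Tendsto f (comap h (𝓝 0)) (𝓝 0) := by
  refine IsBigO.trans_tendsto hf ?_
  have := (tendsto h).pow n
  rwa [zero_pow hn] at this

theorem comp {Y : Type*} (hf : IsO h n f) (e : Y → X) : IsO (h ∘ e) n (f ∘ e) := by
  refine IsBigO.comp_tendsto hf ?_
  rw [tendsto_comap_iff]
  exact tendsto_comap

/-- An element of `X` will bundle a whole solution with a point of it, so a threshold on `h` alone
expresses uniformity in everything else. -/
theorem eventually_iff {p : X → Prop} (hpos : ∀ x, 0 < h x) :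
    (∀ᶠ x in comap h (𝓝 0), p x) ↔ ∃ δ > 0, ∀ x, h x < δ → p x := by
  rw [Filter.eventually_comap, Metric.eventually_nhds_iff]
  constructor
  · rintro ⟨δ, hδ, H⟩
    exact ⟨δ, hδ, fun x hx => H (by simpa [abs_of_pos (hpos x)] using hx) x rfl⟩
  · rintro ⟨δ, hδ, H⟩
    refine ⟨δ, hδ, fun y hy x hx => H x ?_⟩
    subst hx
    simpa [abs_of_pos (hpos x)] using hy

theorem bound (hf : IsO h n f) (hpos : ∀ x, 0 < h x) :
    ∃ C ≥ 0, ∃ δ > 0, ∀ x, h x < δ → |f x| ≤ C * h x ^ n := by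
  obtain ⟨C, hC, H⟩ := IsBigO.exists_nonneg hf
  obtain ⟨δ, hδ, H⟩ := (eventually_iff hpos).1 H.bound
  refine ⟨C, hC, δ, hδ, fun x hx => ?_⟩
  simpa [abs_of_pos (hpos x)] using H x hx

/-- Cancellation of a factor that is bounded below by a multiple of `h ^ k`. -/
theorem cancel (hfg : IsO h (n + k) (fun x => f x * g x)) (hpos : ∀ x, 0 < h x) {c : ℝ}
    (hc : 0 < c) (hg : ∀ᶠ x in comap h (𝓝 0), c * h x ^ k ≤ |g x|) : IsO h n f := by
  obtain ⟨C, hC, H⟩ := IsBigO.exists_nonneg hfg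
  refine IsBigO.of_bound (C / c) ?_
  filter_upwards [H.bound, hg] with x h1 h2
  have hp := hpos x
  rw [norm_mul, Real.norm_eq_abs, Real.norm_eq_abs, pow_add, norm_mul, norm_pow, norm_pow,
    Real.norm_eq_abs, abs_of_pos hp] at h1
  rw [Real.norm_eq_abs, norm_pow, Real.norm_eq_abs, abs_of_pos hp, div_mul_eq_mul_div,
    le_div_iff₀ hc]
  have h3 : |f x| * (c * h x ^ k) ≤ C * (h x ^ n * h x ^ k) :=
    (mul_le_mul_of_nonneg_left h2 (abs_nonneg _)).trans h1
  have h4 : 0 < h x ^ k := by positivity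
  refine le_of_mul_le_mul_right ?_ h4
  linarith

end IsO

/-! ### First orders of magnitude, and integration of estimates -/

/-- A solution of the reduced problem with a point of its no-transaction region. The size `h` is the
cube root of the proportional round trip cost. -/
structure Pt (P : Params) where
  h : ℝ
  L : ℝ
  a : ℝ
  b : ℝ
  g : ℝ → ℝ
  I : ℝ → ℝ
  G : ℝ → ℝ
  red : Reduced P L a b g I G
  h_pos : 0 < h
  L_le : L ≤ h ^ 3
  abs_L_sub : |L - h ^ 3| ≤ h ^ 6
  q : ℝ
  mem : q ∈ Icc a b

namespace Pt

variable {P : Params}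

/-- The same solution at another point. -/
def move (x : Pt P) (q : ℝ) (hq : q ∈ Icc x.a x.b) : Pt P := { x with q := q, mem := hq }

/-- The same solution at the right boundary. -/
def right (x : Pt P) : Pt P := x.move x.b x.red.right_mem

noncomputable def s (x : Pt P) : ℝ := x.q - P.qM
noncomputable def u (x : Pt P) : ℝ := P.qM - x.a
noncomputable def v (x : Pt P) : ℝ := x.b - P.qM
def gq (x : Pt P) : ℝ := x.g x.q
def Iq (x : Pt P) : ℝ := x.I x.q
def Gq (x : Pt P) : ℝ := x.G x.q
noncomputable def nq (x : Pt P) : ℝ := P.rate x.g x.q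
def A (x : Pt P) : ℝ := x.q * (1 - x.q)

abbrev O (P : Params) (n : ℕ) (f : Pt P → ℝ) : Prop := IsO Pt.h n f

theorem O.right {n : ℕ} {f : Pt P → ℝ} (hf : O P n f) : O P n (fun x => f x.right) :=
  IsO.comp hf Pt.right

theorem hpos (x : Pt P) : 0 < x.h := x.h_pos

theorem u_pos (x : Pt P) : 0 < x.u := sub_pos.2 x.red.left_lt
theorem v_pos (x : Pt P) : 0 < x.v := sub_pos.2 x.red.lt_right

theorem L_nonneg (x : Pt P) : 0 ≤ x.L := by
  have := x.red.I_nonneg x.red.right_mem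
  rwa [x.red.I_right] at this

theorem O_L : O P 3 (fun x => x.L) := by
  refine (IsO.self_pow 3).of_abs_le 1 (Eventually.of_forall fun x => ?_)
  rw [abs_of_nonneg x.L_nonneg, one_mul]
  exact x.L_le.trans (le_abs_self _)

theorem O_L_sub : O P 6 (fun x => x.L - x.h ^ 3) := by
  refine (IsO.self_pow 6).of_abs_le 1 (Eventually.of_forall fun x => ?_)
  rw [one_mul]
  exact x.abs_L_sub.trans (le_abs_self _)

theorem O_I : O P 3 (fun x => x.Iq) := by
  refine O_L.of_abs_le 1 (Eventually.of_forall fun x => ?_)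
  rw [one_mul, abs_of_nonneg x.L_nonneg, Pt.Iq, abs_of_nonneg (x.red.I_nonneg x.mem)]
  exact x.red.I_le x.mem

theorem O_cubes (hR : 0 < P.R) : O P 3 (fun x => x.u ^ 3 + x.v ^ 3) := by
  obtain ⟨C, hC⟩ := Reduced.exists_cube_le hR
  have h1 : ∀ᶠ x : Pt P in comap Pt.h (𝓝 0), x.L ≤ 1 := by
    have := (O_L (P := P)).tendsto_zero (by norm_num)
    exact (this.eventually (gt_mem_nhds one_pos)).mono fun x hx => hx.le
  refine O_L.of_abs_le C ?_
  filter_upwards [h1] with x hx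
  have hu := x.u_pos
  have hv := x.v_pos
  rw [abs_of_nonneg (by positivity), abs_of_nonneg x.L_nonneg]
  exact hC x.red hx

theorem O_u (hR : 0 < P.R) : O P 1 (fun x => x.u) := by
  refine IsO.of_pow (j := 3) (by norm_num) ((O_cubes hR).of_abs_le 1 ?_)
  refine Eventually.of_forall fun x => ?_
  have hu := pow_pos x.u_pos 3
  have hv := pow_pos x.v_pos 3
  rw [abs_of_pos hu, abs_of_pos (by linarith)]; linarith

theorem O_v (hR : 0 < P.R) : O P 1 (fun x => x.v) := by
  refine IsO.of_pow (j := 3) (by norm_num) ((O_cubes hR).of_abs_le 1 ?_)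
  refine Eventually.of_forall fun x => ?_
  have hu := pow_pos x.u_pos 3
  have hv := pow_pos x.v_pos 3
  rw [abs_of_pos hv, abs_of_pos (by linarith)]; linarith

theorem O_s (hR : 0 < P.R) : O P 1 (fun x => x.s) := by
  refine ((O_u hR).add (O_v hR)).of_abs_le 1 (Eventually.of_forall fun x => ?_)
  have hu := x.u_pos
  have hv := x.v_pos
  have h1 := x.mem.1
  have h2 := x.mem.2
  rw [abs_of_pos (by linarith : 0 < x.u + x.v), abs_le]
  simp only [u, v, s] at *
  constructor <;> linarith

/-- Integration of an estimate from the left boundary. -/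
theorem O.integrate (hR : 0 < P.R) {n : ℕ} {F f : Pt P → ℝ → ℝ}
    (hF : ∀ x, ∀ q ∈ Icc x.a x.b, HasDerivWithinAt (F x) (f x q) (Icc x.a x.b) q)
    (h0 : ∀ x, F x x.a = 0)
    (hmove : ∀ x q (hq : q ∈ Icc x.a x.b), f (x.move q hq) q = f x q)
    (hf : O P n (fun x => f x x.q)) : O P (n + 1) (fun x => F x x.q) := by
  obtain ⟨C, hC, δ, hδ, H⟩ := IsO.bound hf hpos
  have h1 : O P (n + 1) (fun x => x.h ^ n * (x.u + x.v)) :=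
    (IsO.self_pow n).mul ((O_u hR).add (O_v hR))
  refine h1.of_abs_le C ((IsO.eventually_iff hpos).2 ⟨δ, hδ, fun x hx => ?_⟩)
  -- The hypothesis speaks of the bundled point only; moving that point along the same solution
  -- makes it a bound on the whole interval, whose length `u + v` is `O(h)`.
  have hb : ∀ q ∈ Icc x.a x.b, ‖f x q‖ ≤ C * x.h ^ n := fun q hq => by
    have := H (x.move q hq) hx
    rw [Real.norm_eq_abs, ← hmove x q hq]
    exact this
  have h2 := (convex_Icc x.a x.b).norm_image_sub_le_of_norm_hasDerivWithin_le (hF x) hb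
    x.red.left_mem x.mem
  rw [h0, sub_zero, Real.norm_eq_abs, Real.norm_eq_abs, abs_of_nonneg (sub_nonneg.2 x.mem.1)] at h2
  have hh := x.h_pos
  have hu := x.u_pos
  have hv := x.v_pos
  rw [abs_of_pos (show 0 < x.h ^ n * (x.u + x.v) by positivity), ← mul_assoc]
  refine h2.trans ?_
  have h3 : x.q - x.a ≤ x.u + x.v := by
    have := x.mem.2
    simp only [u, v]; linarith
  gcongr

end Pt

/-! ### Successive expansions in powers of `h` -/

noncomputable section

/-- The value `qM * (1 - qM)` of `q * (1 - q)` at the Merton ratio. -/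
def Params.A0 (P : Params) : ℝ := P.qM * (1 - P.qM)

/-- Inverse of the leading coefficient of the weight. -/
def Params.w0 (P : Params) : ℝ := (P.A0 ^ 2)⁻¹

/-- Coefficient of `I` in the expansion of the excess. -/
def Params.B (P : Params) : ℝ := 2 / P.σ ^ 2 * P.mM * P.qM

/-- Coefficient of the first order term in the expansion of the weight. -/
def Params.j (P : Params) : ℝ := 2 * P.A0 * (1 - 2 * P.qM)

theorem Params.Regular.A0_ne {P : Params} (hP : P.Regular) : P.A0 ≠ 0 :=
  mul_ne_zero hP.qM_ne_zero (sub_ne_zero.2 hP.qM_ne_one.symm)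

theorem Params.Regular.w0_mul {P : Params} (hP : P.Regular) : P.w0 * P.A0 ^ 2 = 1 :=
  inv_mul_cancel₀ (pow_ne_zero _ hP.A0_ne)

namespace Pt

variable {P : Params}

/-- The leading parabola of the excess. -/
def par (x : Pt P) : ℝ := P.R * (x.u ^ 2 - x.s ^ 2)

def w (x : Pt P) : ℝ := x.A * (x.A - x.gq)

theorem w_mul_G (x : Pt P) : x.w * x.Gq = x.gq := x.red.mul_G x.q x.mem

theorem O_sub_par (hP : P.Regular) : O P 3 (fun x => x.gq - x.par) := by
  refine O_I.of_abs_le P.devBound (Eventually.of_forall fun x => ?_)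
  rw [abs_of_nonneg (show 0 ≤ x.Iq from x.red.I_nonneg x.mem)]
  exact x.red.abs_g_sub_le hP.R_pos x.mem

theorem O_par (hP : P.Regular) : O P 2 (fun x => x.par) :=
  (((O_u hP.R_pos).pow 2).sub ((O_s hP.R_pos).pow 2)).const_mul P.R

theorem O_g (hP : P.Regular) : O P 2 (fun x => x.gq) :=
  (((O_sub_par hP).mono (by norm_num)).add (O_par hP)).of_eq fun x => by ring

theorem O_A1 (hP : P.Regular) : O P 1 (fun x => x.A - P.A0) := by
  have h1 := O_s hP.R_pos
  refine ((h1.const_mul (1 - 2 * P.qM)).sub ((h1.pow 2).mono (by norm_num))).of_eq fun x => ?_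
  simp only [A, s, Params.A0]; ring

theorem O_A (hP : P.Regular) : O P 0 (fun x => x.A) :=
  (((O_A1 hP).mono (by norm_num)).add (IsO.const P.A0)).of_eq fun x => by ring

theorem O_w2 (hP : P.Regular) : O P 2 (fun x => x.w - P.A0 ^ 2 - P.j * x.s) := by
  have h1 : O P 2 (fun x => x.A - P.A0 - (1 - 2 * P.qM) * x.s) := by
    refine (((O_s hP.R_pos).pow 2).const_mul (-1)).of_eq fun x => ?_
    simp only [A, s, Params.A0]; ring
  refine ((((O_A1 hP).pow 2).add (h1.const_mul (2 * P.A0))).sub ((O_A hP).mul (O_g hP))).of_eq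
    fun x => ?_
  simp only [w, Params.j]; ring

theorem O_w1 (hP : P.Regular) : O P 1 (fun x => x.w - P.A0 ^ 2) :=
  (((O_w2 hP).mono (by norm_num)).add ((O_s hP.R_pos).const_mul P.j)).of_eq fun x => by ring

/-- The weight tends to `A0² > 0`, so it eventually exceeds `A0² / 2` and `G = g / w` inherits the
order of `g`. -/
theorem O_G (hP : P.Regular) : O P 2 (fun x => x.Gq) := by
  refine (O_g hP).of_abs_le (2 * P.w0) ?_
  have hA : 0 < P.A0 ^ 2 := by have := hP.A0_ne; positivity
  have h1 := ((O_w1 hP).tendsto_zero (by norm_num)).abs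
  rw [abs_zero] at h1
  filter_upwards [h1.eventually (gt_mem_nhds (half_pos hA))] with x hx
  have h2 : P.A0 ^ 2 / 2 ≤ x.w := by have := (abs_lt.1 hx).1; linarith
  have hG : 0 ≤ x.Gq := x.red.G_nonneg x.q x.mem
  have hg : 0 ≤ x.gq := x.red.g_nonneg x.q x.mem
  rw [abs_of_nonneg hG, abs_of_nonneg hg, ← x.w_mul_G, Params.w0, ← div_eq_mul_inv,
    div_mul_eq_mul_div, le_div_iff₀ hA]
  nlinarith

theorem O_G1 (hP : P.Regular) : O P 3 (fun x => x.Gq - P.w0 * x.par) := by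
  refine (((O_sub_par hP).const_mul P.w0).sub
    (((O_G hP).mul (O_w1 hP)).const_mul P.w0)).of_eq fun x => ?_
  linear_combination P.w0 * x.w_mul_G - x.Gq * hP.w0_mul

/-- Solves `w G = g` one order further: `w = A0² + j s + O(h²)`, and in the correction `j s G` the
leading value of `G` suffices. -/
theorem O_G2 (hP : P.Regular) :
    O P 4 (fun x => x.Gq - P.w0 * (x.gq - P.j * x.s * (P.w0 * x.par))) := by
  refine ((((O_G hP).mul (O_w2 hP)).add
    (((O_s hP.R_pos).mul (O_G1 hP)).const_mul P.j)).const_mul (-P.w0)).of_eq fun x => ?_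
  linear_combination P.w0 * x.w_mul_G - x.Gq * hP.w0_mul

theorem O_q (hP : P.Regular) : O P 0 (fun x => x.q) :=
  (((O_s hP.R_pos).mono (by norm_num)).add (IsO.const P.qM)).of_eq fun x => by
    simp only [s]; ring

/-- There is no first order term because `m` is stationary at `qM` and `g = O(h²)`. -/
theorem O_n (hP : P.Regular) : O P 2 (fun x => x.nq - P.mM) := by
  refine (((((O_s hP.R_pos).pow 2).const_mul P.R).add (O_g hP)).const_mul P.gap).of_eq fun x => ?_
  simp only [nq, Params.rate, s, gq]; ring

/-- In `g'` the factor `n q` equals `mM * qM + O(h)`, so the forcing is `-B G` up to `O(h³)`;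
integration replaces `B G` by `B I`. -/
theorem O_sub_par_add (hP : P.Regular) : O P 4 (fun x => x.gq - x.par + P.B * x.Iq) := by
  refine O.integrate hP.R_pos (n := 3)
    (F := fun x q => x.g q - P.R * (x.u ^ 2 - (q - P.qM) ^ 2) + P.B * x.I q)
    (f := fun x q => P.B * x.G q - 2 / P.σ ^ 2 * (P.rate x.g q * q * x.G q)) ?_ ?_ ?_ ?_
  · intro x q hq
    have h1 := ((((hasDerivAt_id q).sub_const P.qM).pow 2).const_sub (x.u ^ 2)).const_mul P.R
    refine (((x.red.deriv_g q hq).sub h1.hasDerivWithinAt).add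
      ((x.red.deriv_I q hq).const_mul P.B)).congr_deriv ?_
    simp; ring
  · intro x
    simp only [x.red.g_left, x.red.I_left, u]; ring
  · intro x q hq; rfl
  · refine (((O_G hP).mul ((((O_n hP).mul (O_q hP)).mono (k := 1) (by norm_num)).add
      ((O_s hP.R_pos).const_mul P.mM))).const_mul (-(2 / P.σ ^ 2))).of_eq fun x => ?_
    simp only [Gq, nq, s, Params.B]; ring

/-- Primitive of the leading parabola. -/
def W (x : Pt P) : ℝ := x.u ^ 2 * x.s - x.s ^ 3 / 3 + 2 / 3 * x.u ^ 3

theorem O_I1 (hP : P.Regular) : O P 4 (fun x => x.Iq - P.w0 * P.R * x.W) := by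
  refine O.integrate hP.R_pos (n := 3)
    (F := fun x q => x.I q - P.w0 * P.R *
      (x.u ^ 2 * (q - P.qM) - (q - P.qM) ^ 3 / 3 + 2 / 3 * x.u ^ 3))
    (f := fun x q => x.G q - P.w0 * (P.R * (x.u ^ 2 - (q - P.qM) ^ 2))) ?_ ?_ ?_ ?_
  · intro x q hq
    have h0 := (hasDerivAt_id q).sub_const P.qM
    have h1 := (((h0.const_mul (x.u ^ 2)).sub ((h0.pow 3).div_const 3)).add_const
      (2 / 3 * x.u ^ 3)).const_mul (P.w0 * P.R)
    refine ((x.red.deriv_I q hq).sub h1.hasDerivWithinAt).congr_deriv ?_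
    simp; ring
  · intro x
    simp only [x.red.I_left, u]; ring
  · intro x q hq; rfl
  · exact O_G1 hP

theorem O_G3 (hP : P.Regular) : O P 4 (fun x => x.Gq - P.w0 * P.R *
    ((x.u ^ 2 - x.s ^ 2) * (1 - P.j * P.w0 * x.s) - P.B * P.w0 * x.W)) := by
  refine (((O_G2 hP).add ((O_sub_par_add hP).const_mul P.w0)).sub
    ((O_I1 hP).const_mul (P.w0 * P.B))).of_eq fun x => ?_
  simp only [par]; ring

/-- Integrates `O_G3` termwise. The terms `2/3 u³` (in `W`) and `u⁴/4` are the constants that make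
the primitives vanish at the left boundary, where `s = -u`. -/
theorem O_I2 (hP : P.Regular) : O P 5 (fun x => x.Iq - P.w0 * P.R *
    (x.W + P.j * P.w0 * ((x.u ^ 2 - x.s ^ 2) ^ 2 / 4) - P.B * P.w0 *
      (x.u ^ 2 * x.s ^ 2 / 2 - x.s ^ 4 / 12 + 2 / 3 * x.u ^ 3 * x.s + x.u ^ 4 / 4))) := by
  refine O.integrate hP.R_pos (n := 4)
    (F := fun x q => x.I q - P.w0 * P.R *
      (x.u ^ 2 * (q - P.qM) - (q - P.qM) ^ 3 / 3 + 2 / 3 * x.u ^ 3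
      + P.j * P.w0 * ((x.u ^ 2 - (q - P.qM) ^ 2) ^ 2 / 4) - P.B * P.w0 *
      (x.u ^ 2 * (q - P.qM) ^ 2 / 2 - (q - P.qM) ^ 4 / 12 + 2 / 3 * x.u ^ 3 * (q - P.qM)
        + x.u ^ 4 / 4)))
    (f := fun x q => x.G q - P.w0 * P.R *
      ((x.u ^ 2 - (q - P.qM) ^ 2) * (1 - P.j * P.w0 * (q - P.qM)) - P.B * P.w0 *
      (x.u ^ 2 * (q - P.qM) - (q - P.qM) ^ 3 / 3 + 2 / 3 * x.u ^ 3))) ?_ ?_ ?_ ?_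
  · intro x q hq
    have h0 := (hasDerivAt_id q).sub_const P.qM
    have h1 := ((h0.const_mul (x.u ^ 2)).sub ((h0.pow 3).div_const 3)).add_const
      (2 / 3 * x.u ^ 3)
    have h2 := ((((h0.pow 2).const_sub (x.u ^ 2)).pow 2).div_const 4).const_mul (P.j * P.w0)
    have h3 := ((((((h0.pow 2).const_mul (x.u ^ 2)).div_const 2).sub
      ((h0.pow 4).div_const 12)).add (h0.const_mul (2 / 3 * x.u ^ 3))).add_const
      (x.u ^ 4 / 4)).const_mul (P.B * P.w0)
    refine ((x.red.deriv_I q hq).sub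
      (((h1.add h2).sub h3).const_mul (P.w0 * P.R)).hasDerivWithinAt).congr_deriv ?_
    simp only [id, Pi.pow_apply]; push_cast; ring
  · intro x
    simp only [x.red.I_left, u]; ring
  · intro x q hq; rfl
  · exact O_G3 hP

theorem right_u (x : Pt P) : x.right.u = x.u := rfl
theorem right_s (x : Pt P) : x.right.s = x.v := rfl
theorem right_I (x : Pt P) : x.right.Iq = x.L := x.red.I_right
theorem right_g (x : Pt P) : x.right.gq = 0 := x.red.g_right

/-- The second boundary condition `g b = 0` measures the asymmetry of the interval about `qM`. -/
theorem O_boundary (hP : P.Regular) :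
    O P 4 (fun x => P.R * (x.u ^ 2 - x.v ^ 2) - P.B * x.L) := by
  refine ((O_sub_par_add hP).right.const_mul (-1)).of_eq fun x => ?_
  simp only [par, right_u, right_s, right_I, right_g]; ring

theorem O_total1 (hP : P.Regular) :
    O P 4 (fun x => x.L - P.w0 * P.R * (x.u ^ 2 * x.v - x.v ^ 3 / 3 + 2 / 3 * x.u ^ 3)) := by
  refine (O_I1 hP).right.of_eq fun x => ?_
  simp only [W, right_u, right_s, right_I]

theorem O_total2 (hP : P.Regular) : O P 5 (fun x => x.L - P.w0 * P.R *
    (x.u ^ 2 * x.v - x.v ^ 3 / 3 + 2 / 3 * x.u ^ 3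
      + P.j * P.w0 * ((x.u ^ 2 - x.v ^ 2) ^ 2 / 4) - P.B * P.w0 *
      (x.u ^ 2 * x.v ^ 2 / 2 - x.v ^ 4 / 12 + 2 / 3 * x.u ^ 3 * x.v + x.u ^ 4 / 4))) := by
  refine (O_I2 hP).right.of_eq fun x => ?_
  simp only [W, right_u, right_s, right_I]

/-- The no-transaction region is not smaller than a multiple of `h`. -/
theorem exists_width_ge (hP : P.Regular) :
    ∃ c > 0, ∀ᶠ x : Pt P in comap Pt.h (𝓝 0), c * x.h ^ 1 ≤ |x.u + x.v| := by
  obtain ⟨C, hC, δ, hδ, H⟩ := IsO.bound (O_G hP) hpos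
  -- Since `I' = G ≤ C h²`, one has `L ≤ C h² (u + v)`, while `L ≥ h³ - h⁶ ≥ h³/2` for `h < 1/2`.
  -- Using `C + 1` keeps the denominator positive.
  refine ⟨1 / (2 * (C + 1)), by positivity,
    (IsO.eventually_iff hpos).2 ⟨min δ (1 / 2), by positivity, fun x hx => ?_⟩⟩
  have hx1 := hx.trans_le (min_le_left _ _)
  have hx2 := hx.trans_le (min_le_right _ _)
  have hb : ∀ q ∈ Icc x.a x.b, ‖x.G q‖ ≤ C * x.h ^ 2 := fun q hq => H (x.move q hq) hx1
  have h2 := (convex_Icc x.a x.b).norm_image_sub_le_of_norm_hasDerivWithin_le x.red.deriv_I hb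
    x.red.left_mem x.red.right_mem
  have hu := x.u_pos
  have hv := x.v_pos
  have hh := x.h_pos
  have hw : x.b - x.a = x.u + x.v := by simp only [u, v]; ring
  rw [x.red.I_left, x.red.I_right, sub_zero, Real.norm_eq_abs, Real.norm_eq_abs,
    abs_of_nonneg x.L_nonneg, hw, abs_of_pos (by linarith)] at h2
  rw [abs_of_pos (by linarith), pow_one, div_mul_eq_mul_div, one_mul, div_le_iff₀ (by positivity)]
  have h3 := (abs_le.1 x.abs_L_sub).1
  have h4 : x.h ^ 6 ≤ x.h ^ 3 / 2 := by
    have : x.h ^ 3 ≤ (1 / 2) ^ 3 := pow_le_pow_left₀ hh.le hx2.le 3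
    have h5 : 0 < x.h ^ 3 := by positivity
    nlinarith [show x.h ^ 6 = x.h ^ 3 * x.h ^ 3 by ring]
  have h5 : x.h ^ 3 / 2 ≤ C * x.h ^ 2 * (x.u + x.v) := by linarith
  have h6 : x.h ^ 2 * x.h ≤ x.h ^ 2 * ((x.u + x.v) * (2 * (C + 1))) := by
    have : 0 < x.h ^ 2 * (x.u + x.v) := by positivity
    nlinarith
  exact le_of_mul_le_mul_left h6 (by positivity)

/-- `O_boundary` gives `(u - v)(u + v) = O(h³)`, and `u + v` is at least a multiple of `h`. -/
theorem O_asym (hP : P.Regular) : O P 2 (fun x => x.u - x.v) := by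
  obtain ⟨c, hc, H⟩ := exists_width_ge hP
  refine IsO.cancel (k := 1) ?_ hpos hc H
  refine ((((O_boundary hP).mono (k := 3) (by norm_num)).add
    (O_L.const_mul P.B)).const_mul P.R⁻¹).of_eq fun x => ?_
  have := hP.R_pos.ne'
  field_simp
  ring

/-- Half the width of the no-transaction region. -/
def D (x : Pt P) : ℝ := (x.u + x.v) / 2

theorem O_D (hP : P.Regular) : O P 1 (fun x => x.D) :=
  (((O_u hP.R_pos).add (O_v hP.R_pos)).const_mul (1 / 2)).of_eq fun x => by simp only [D]; ring

theorem O_sq_sub (hP : P.Regular) : O P 3 (fun x => x.u ^ 2 - x.v ^ 2) :=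
  ((O_asym hP).mul ((O_u hP.R_pos).add (O_v hP.R_pos))).of_eq fun x => by ring

/-- All terms of order `h⁴` cancel. The cubic in `O_total2` equals `4/3 D³ + D (u² - v²)` exactly,
and `O_boundary` turns `R D (u² - v²)` into `B D L`, that is `B w0 R (4/3) D⁴` to leading order.
This is what the quartic term subtracts. The `j` term is `O(h⁶)`, being quadratic in `u² - v²`. -/
theorem O_L_sub_cube (hP : P.Regular) :
    O P 5 (fun x => x.L - P.w0 * P.R * (4 / 3 * x.D ^ 3)) := by
  have hη := O_asym hP
  have hD := O_D hP
  have hu := O_u hP.R_pos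
  have hv := O_v hP.R_pos
  have hB := O_boundary hP
  -- At `u = v = D` the quartic is `(1/2 - 1/12 + 2/3 + 1/4) D⁴ = 4/3 D⁴`; the difference has the
  -- factor `u - v = O(h²)`.
  have r2 : O P 5 (fun x => x.u ^ 2 * x.v ^ 2 / 2 - x.v ^ 4 / 12 + 2 / 3 * x.u ^ 3 * x.v
      + x.u ^ 4 / 4 - 4 / 3 * x.D ^ 4) := by
    refine (hη.mul ((((hu.pow 3).const_mul (1 / 6)).add
      (((hu.pow 2).mul hv).const_mul (1 / 2))).add
        ((hu.mul (hv.pow 2)).const_mul (1 / 2) |>.add ((hv.pow 3).const_mul (1 / 6))))).of_eq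
      fun x => ?_
    simp only [D]; ring
  have r3 : O P 5 (fun x => (x.u ^ 2 - x.v ^ 2) ^ 2 / 4) :=
    ((((O_sq_sub hP).pow 2).const_mul (1 / 4)).mono (by norm_num)).of_eq fun x => by ring
  have r4 : O P 4 (fun x => x.L - P.w0 * P.R * (4 / 3 * x.D ^ 3)) := by
    refine ((O_total1 hP).add ((hD.mul (O_sq_sub hP)).const_mul (P.w0 * P.R))).of_eq fun x => ?_
    simp only [D]; ring
  refine (((O_total2 hP).add (((r3.const_mul (P.j * P.w0)).sub
    (r2.const_mul (P.B * P.w0))).const_mul (P.w0 * P.R))).add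
    (((hD.mul hB).const_mul P.w0).add ((hD.mul r4).const_mul (P.w0 * P.B)))).of_eq fun x => ?_
  simp only [D]; ring

/-- The cube root of `Delta`. -/
def _root_.EpsteinZin.Params.δ₀ (P : Params) : ℝ := P.Delta ^ (1 / 3 : ℝ)

theorem _root_.EpsteinZin.Params.Regular.Delta_pos (hP : P.Regular) : 0 < P.Delta := by
  have h1 := hP.A0_ne
  have h2 := hP.R_pos
  have : P.Delta = 3 * P.A0 ^ 2 / (4 * P.R) := by simp only [Params.Delta, Params.A0]; ring
  rw [this]; positivity

theorem _root_.EpsteinZin.Params.Regular.δ₀_pos (hP : P.Regular) : 0 < P.δ₀ :=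
  Real.rpow_pos_of_pos hP.Delta_pos _

theorem _root_.EpsteinZin.Params.Regular.δ₀_cube (hP : P.Regular) : P.δ₀ ^ 3 = P.Delta := by
  rw [Params.δ₀, ← Real.rpow_natCast, ← Real.rpow_mul hP.Delta_pos.le]; norm_num

theorem _root_.EpsteinZin.Params.Regular.w0_R_δ₀ (hP : P.Regular) :
    P.w0 * P.R * (4 / 3) * P.δ₀ ^ 3 = 1 := by
  have h2 := hP.R_pos.ne'
  have h3 := hP.w0_mul
  have : P.Delta = 3 * P.A0 ^ 2 / (4 * P.R) := by simp only [Params.Delta, Params.A0]; ring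
  rw [hP.δ₀_cube, this]
  field_simp
  linarith

/-- `D³ - (δ₀ h)³ = O(h⁵)` by `O_L_sub_cube`, and the cofactor of `D - δ₀ h` is at least `δ₀² h²`.
-/
theorem O_D_sub (hP : P.Regular) : O P 3 (fun x => x.D - P.δ₀ * x.h) := by
  have h1 : O P 5 (fun x => (x.D - P.δ₀ * x.h) *
      (x.D ^ 2 + x.D * (P.δ₀ * x.h) + (P.δ₀ * x.h) ^ 2)) := by
    refine (((O_L_sub_cube hP).const_mul (-P.δ₀ ^ 3)).add
      ((O_L_sub.mono (k := 5) (by norm_num)).const_mul (P.δ₀ ^ 3))).of_eq fun x => ?_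
    linear_combination -x.D ^ 3 * hP.w0_R_δ₀
  have hδ := hP.δ₀_pos
  refine IsO.cancel (k := 2) h1 hpos (c := P.δ₀ ^ 2) (by positivity)
    (Eventually.of_forall fun x => ?_)
  have hh := x.h_pos
  have hD : 0 < x.D := by
    have := x.u_pos; have := x.v_pos; simp only [D]; linarith
  rw [abs_of_pos (by positivity)]
  nlinarith [show 0 < x.D ^ 2 + x.D * (P.δ₀ * x.h) by positivity]

/-- Expansion of the consumption rate per unit of shadow wealth. -/
theorem O_rate (hP : P.Regular) : O P 4 (fun x => x.nq - (P.mM + P.gap * P.R * (P.δ₀ * x.h) ^ 2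
    + P.gap * P.B * (x.h ^ 3 / 2 - x.Iq))) := by
  -- In `n = mM + gap (R s² + g)` the terms in `s²` cancel, which leaves `R u² - B I`. Here `u² = D²
  -- + (u - v)²/4 + (u² - v²)/2`, and by `O_boundary` the last part contributes `B L / 2`, hence the
  -- `h³ / 2`.
  have h1 : O P 4 (fun x => (x.D - P.δ₀ * x.h) * (x.D + P.δ₀ * x.h)) :=
    (O_D_sub hP).mul ((O_D hP).add (IsO.self.const_mul P.δ₀))
  refine ((((O_sub_par_add hP).add ((h1.add (((O_asym hP).pow 2).const_mul (1 / 4))).const_mul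
    P.R)).add (((O_boundary hP).add ((O_L_sub.mono (k := 4) (by norm_num)).const_mul P.B)).const_mul
    (1 / 2))).const_mul P.gap).of_eq fun x => ?_
  simp only [nq, Params.rate, par, D, gq, s]
  ring

/-- Expansion of the decrease of the logarithm of the relative shadow price. -/
theorem O_shadow (hP : P.Regular) : O P 4 (fun x => x.Iq - P.w0 * P.R *
    ((P.δ₀ * x.h) ^ 2 * x.s - x.s ^ 3 / 3 + 2 / 3 * (P.δ₀ * x.h) ^ 3)) := by
  have hd : O P 1 (fun x => P.δ₀ * x.h) := IsO.self.const_mul P.δ₀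
  have hu := O_u hP.R_pos
  have h1 : O P 2 (fun x => x.u - P.δ₀ * x.h) :=
    (((O_D_sub hP).mono (k := 2) (by norm_num)).add ((O_asym hP).const_mul (1 / 2))).of_eq
      fun x => by simp only [D]; ring
  refine ((O_I1 hP).add (((h1.mul ((hu.add hd).mul (O_s hP.R_pos))).add
    ((h1.mul (((hu.pow 2).add (hu.mul hd)).add (hd.pow 2))).const_mul (2 / 3))).const_mul
    (P.w0 * P.R))).of_eq fun x => ?_
  simp only [W]; ring

end Pt

end

/-! ### Shadow data solve the reduced problem -/

theorem Icc_subset_closure_diff_singleton {a b : ℝ} (h : a < b) (c : ℝ) :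
    Icc a b ⊆ closure (Icc a b \ {c}) := by
  rw [← closure_Ioo h.ne]
  refine closure_minimal ?_ isClosed_closure
  refine ((dense_compl_singleton c).open_subset_closure_inter isOpen_Ioo).trans
    (closure_mono fun x hx => ⟨?_, hx.2⟩)
  rw [closure_Ioo h.ne]
  exact Ioo_subset_Icc_self hx.1

theorem pos_of_ne_zero_of_pos {f : ℝ → ℝ} {s : Set ℝ} (hs : s.OrdConnected)
    (hf : ContinuousOn f s) (h0 : ∀ x ∈ s, f x ≠ 0) {x y : ℝ} (hx : x ∈ s) (hy : y ∈ s)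
    (h : 0 < f x) : 0 < f y := by
  by_contra hlt
  obtain ⟨z, hz, hz0⟩ := hs.isPreconnected.intermediate_value hy hx hf ⟨not_lt.1 hlt, h.le⟩
  exact h0 z hz hz0

namespace FreeBoundary

variable {P : Params} {ξ a b : ℝ} {n : ℝ → ℝ}

theorem left_lt (h : FreeBoundary P ξ a b n) (hP : P.Regular) : a < P.qM := by
  rcases lt_or_gt_of_ne hP.qM_ne_zero with h0 | h0
  · exact (h.loc_neg h0).2.1
  rcases lt_or_gt_of_ne hP.qM_ne_one with h1 | h1
  · exact (h.loc_mid h0 h1).2.1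
  · exact (h.loc_big h1).2.1

theorem lt_right (h : FreeBoundary P ξ a b n) (hP : P.Regular) : P.qM < b := by
  rcases lt_or_gt_of_ne hP.qM_ne_zero with h0 | h0
  · exact (h.loc_neg h0).2.2.1
  rcases lt_or_gt_of_ne hP.qM_ne_one with h1 | h1
  · exact (h.loc_mid h0 h1).2.2.1
  · exact (h.loc_big h1).2.2.1

theorem ne_zero (h : FreeBoundary P ξ a b n) (hP : P.Regular) {q : ℝ} (hq : q ∈ Icc a b) :
    q ≠ 0 := by
  rcases lt_or_gt_of_ne hP.qM_ne_zero with h0 | h0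
  · exact (hq.2.trans_lt (h.loc_neg h0).2.2.2).ne
  rcases lt_or_gt_of_ne hP.qM_ne_one with h1 | h1
  · exact ((h.loc_mid h0 h1).1.trans_le hq.1).ne'
  · exact ((h.loc_big h1).1.trans_le hq.1).ne'

theorem abs_le (h : FreeBoundary P ξ a b n) (hP : P.Regular) {q : ℝ} (hq : q ∈ Icc a b) :
    |q| ≤ 2 * |P.qM| + 1 := by
  obtain ⟨h1, h2⟩ := hq
  rw [_root_.abs_le]
  rcases lt_or_gt_of_ne hP.qM_ne_zero with h0 | h0
  · have := h.loc_neg h0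
    rw [abs_of_neg h0]
    constructor <;> linarith
  rw [abs_of_pos h0]
  rcases lt_or_gt_of_ne hP.qM_ne_one with h3 | h3
  · have := h.loc_mid h0 h3
    constructor <;> linarith
  · have := h.loc_big h3
    constructor <;> linarith

end FreeBoundary

/-- The scaled excess of the consumption rate over its frictionless value. -/
noncomputable def excess (P : Params) (n : ℝ → ℝ) (q : ℝ) : ℝ := (n q - P.m q) / P.gap

theorem rate_excess {P : Params} (hP : P.Regular) (n : ℝ → ℝ) (q : ℝ) :
    P.rate (excess P n) q = n q := by
  simp only [Params.rate, excess, mul_add, mul_div_cancel₀ _ hP.gap_ne]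
  rw [Params.m_eq hP.σ_pos.ne' hP.R_pos.ne']; ring

theorem gap_mul_sub_excess {P : Params} (hP : P.Regular) (n : ℝ → ℝ) (q : ℝ) :
    P.gap * (q * (1 - q) - excess P n q) = P.ell q - n q := by
  rw [mul_sub, ← P.ell_sub_m, excess, mul_div_cancel₀ _ hP.gap_ne]; ring

theorem Params.continuous_m (P : Params) : Continuous P.m := by
  unfold Params.m; fun_prop

/-- The equations of the free boundary problem say nothing at `q = 1`, which may lie in the interval
when `qM > 1`. The reduced form has no singularity there and extends across by continuity. -/
theorem ShadowData.Solves.reduced {P : Params} (hP : P.Regular) {D : ShadowData} {γu γd : ℝ}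
    (hu : 0 < γu) (hd : 0 < γd) (h : D.Solves P γu γd) :
    Reduced P (Real.log (γu * γd)) D.qLow D.qHigh (excess P D.n)
      (fun q => Real.log γu - Real.log (D.κ q))
      (fun q => -(derivWithin D.κ (Icc D.qLow D.qHigh) q / D.κ q)) := by
  obtain ⟨-, hF, hK, -⟩ := h
  set a := D.qLow
  set b := D.qHigh
  set n := D.n
  set κ := D.κ
  set g := excess P n with hg
  set G : ℝ → ℝ := fun q => -(derivWithin κ (Icc a b) q / κ q) with hG
  have hal := hF.left_lt hP
  have hbr := hF.lt_right hP
  have hab : a < b := hal.trans hbr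
  have ha : a ∈ Icc a b := left_mem_Icc.2 hab.le
  have hb : b ∈ Icc a b := right_mem_Icc.2 hab.le
  have hgap := hP.gap_ne
  have hga : g a = 0 := by simp [hg, excess, hF.bd_left]
  have hgb : g b = 0 := by simp [hg, excess, hF.bd_right]
  have hg1 : 1 ∈ Icc a b → g 1 = 0 := fun h1 => by simp [hg, excess, (hF.at_one h1).1]
  have hell := fun q => gap_mul_sub_excess hP n q
  have hmn : ∀ q, P.m q - n q = -(P.gap * g q) := fun q => by
    rw [hg, excess, mul_div_cancel₀ _ hgap]; ring
  have hcont : ContinuousOn g (Icc a b) :=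
    (hF.contDiff.continuousOn.sub P.continuous_m.continuousOn).div_const _
  have hwcont : ContinuousOn (fun q => q * (1 - q) * (q * (1 - q) - g q)) (Icc a b) :=
    ContinuousOn.mul (by fun_prop) (ContinuousOn.sub (by fun_prop) hcont)
  have hA0 : ∀ q ∈ Icc a b, q ≠ 1 → q * (1 - q) ≠ 0 := fun q hq h1 =>
    mul_ne_zero (hF.ne_zero hP hq) (sub_ne_zero.2 h1.symm)
  have hf0 : ∀ q ∈ Icc a b, q ≠ 1 → q * (1 - q) - g q ≠ 0 := fun q hq h1 h0 => by
    have := hell q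
    rw [← hg, h0, mul_zero] at this
    exact hF.ne_ell q hq h1 (by linarith)
  have hw0 : ∀ q ∈ Icc a b, q ≠ 1 → q * (1 - q) * (q * (1 - q) - g q) ≠ 0 := fun q hq h1 =>
    mul_ne_zero (hA0 q hq h1) (hf0 q hq h1)
  -- The weight has no zero on either side of `1`, and at the free boundary on the same side as `q`
  -- it is the square `(q(1-q))²`, since `g` vanishes there.
  have hwpos : ∀ q ∈ Icc a b, q ≠ 1 → 0 < q * (1 - q) * (q * (1 - q) - g q) := by
    intro q hq h1
    rcases lt_or_gt_of_ne h1 with h1 | h1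
    · have hs : Icc a q ⊆ Icc a b := Icc_subset_Icc le_rfl hq.2
      have ha1 : a ≠ 1 := (hq.1.trans_lt h1).ne
      refine pos_of_ne_zero_of_pos (s := Icc a q) ordConnected_Icc (hwcont.mono hs)
        (fun x hx => hw0 x (hs hx) (hx.2.trans_lt h1).ne) (left_mem_Icc.2 hq.1)
        (right_mem_Icc.2 hq.1) ?_
      have := hA0 a ha ha1
      simp only [hga, sub_zero]
      exact mul_self_pos.2 this
    · have hs : Icc q b ⊆ Icc a b := Icc_subset_Icc hq.1 le_rfl
      have hb1 : b ≠ 1 := (h1.trans_le hq.2).ne'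
      refine pos_of_ne_zero_of_pos (s := Icc q b) ordConnected_Icc (hwcont.mono hs)
        (fun x hx => hw0 x (hs hx) (lt_of_lt_of_le h1 hx.1).ne') (right_mem_Icc.2 hq.2)
        (left_mem_Icc.2 hq.2) ?_
      have := hA0 b hb hb1
      simp only [hgb, sub_zero]
      exact mul_self_pos.2 this
  have hGn : ∀ q ∈ Icc a b, 0 ≤ G q := fun q hq => by
    have := hK.anti.derivWithin_nonpos (x := q)
    have h2 := hK.pos q hq
    simp only [hG]
    rw [neg_nonneg]
    exact div_nonpos_of_nonpos_of_nonneg this h2.le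
  have hGe : ∀ q ∈ Icc a b, q ≠ 1 → q * (1 - q) * (q * (1 - q) - g q) * G q = g q := by
    intro q hq h1
    have h2 := (hK.pos q hq).ne'
    have h3 := hA0 q hq h1
    have h4 := hf0 q hq h1
    simp only [hG]
    rw [hK.ode q hq h1, hmn, ← hell, ← hg]
    generalize q * (1 - q) = A at *
    field_simp
  have hmulG : ∀ q ∈ Icc a b, q * (1 - q) * (q * (1 - q) - g q) * G q = g q := by
    intro q hq
    by_cases h1 : q = 1
    · subst h1; rw [hg1 hq]; ring
    · exact hGe q hq h1
  have hw : ∀ q ∈ Icc a b, 0 ≤ q * (1 - q) * (q * (1 - q) - g q) := by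
    intro q hq
    by_cases h1 : q = 1
    · subst h1; simp
    · exact (hwpos q hq h1).le
  have hud := uniqueDiffOn_Icc hab
  have hdκ := fun q hq => ((hK.contDiff.differentiableOn one_ne_zero) q hq).hasDerivWithinAt
  have hdn := fun q hq => ((hF.contDiff.differentiableOn one_ne_zero) q hq).hasDerivWithinAt
  have hGc : ContinuousOn G (Icc a b) :=
    ((hK.contDiff.continuousOn_derivWithin hud le_rfl).div hK.contDiff.continuousOn
      fun q hq => (hK.pos q hq).ne').neg
  -- Eliminating the quotient in favour of `G` removes the factor `1 / (1 - q)`. Both sides are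
  -- continuous, so agreement off `1` suffices.
  have hn' : EqOn (derivWithin n (Icc a b)) (fun q => -(P.gap * (2 / P.σ ^ 2)) * (n q * q * G q))
      (Icc a b) := by
    refine EqOn.of_subset_closure (s := Icc a b \ {1}) ?_
      (hF.contDiff.continuousOn_derivWithin hud le_rfl) ?_ sdiff_subset
      (Icc_subset_closure_diff_singleton hab 1)
    · rintro q ⟨hq, h1⟩
      have h1 : q ≠ 1 := h1
      have h3 := hF.ne_zero hP hq
      have h4 := hf0 q hq h1
      have h5 : 1 - q ≠ 0 := sub_ne_zero.2 h1.symm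
      have hGq : G q = g q / (q * (1 - q) * (q * (1 - q) - g q)) := by
        rw [eq_div_iff (hw0 q hq h1), mul_comm]; exact hGe q hq h1
      have hσ := hP.σ_pos.ne'
      have hS : (1 - P.S) / P.S = P.gap * (2 / P.σ ^ 2) := by
        simp only [Params.gap]; field_simp
      rw [hF.ode q hq h1, hmn, ← hell, ← hg, hS]
      simp only [hGq]
      generalize q * (1 - q) - g q = f at *
      field_simp
    · exact continuousOn_const.mul ((hF.contDiff.continuousOn.mul continuousOn_id).mul hGc)
  refine ⟨hal, hbr, fun q hq => hF.abs_le hP hq, hga, hgb, ?_, ?_, ?_, ?_, ?_, hGn, hmulG, hw, ?_⟩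
  · simp [κ, a, hK.bd_left]
  · simp only [κ, b, hK.bd_right]
    rw [Real.log_mul hu.ne' hd.ne', one_div, Real.log_inv]; ring
  · intro q hq
    exact ((hdκ q hq).log (hK.pos q hq).ne').const_sub _
  · intro q hq
    have hm : HasDerivWithinAt P.m (2 * P.gap * P.R * (q - P.qM)) (Icc a b) q := by
      have h1 := ((((hasDerivAt_id q).sub_const P.qM).pow 2).const_mul
        (P.gap * P.R)).const_add P.mM
      have h2 : P.m = fun q => P.mM + P.gap * P.R * (q - P.qM) ^ 2 :=
        funext (Params.m_eq hP.σ_pos.ne' hP.R_pos.ne')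
      rw [h2]
      refine (h1.congr_deriv ?_).hasDerivWithinAt
      simp; ring
    refine (((hdn q hq).sub hm).div_const P.gap).congr_deriv ?_
    rw [hn' hq, rate_excess hP]
    field_simp
    ring
  · intro q hq
    rw [← hmulG q hq]
    exact mul_nonneg (hw q hq) (hGn q hq)
  · intro q hq
    rw [rate_excess hP, abs_of_pos (hF.pos q hq)]
    have hm : ∀ x ∈ Icc a b, P.m x ≤ P.rateBound := by
      intro x hx
      rw [Params.m_eq hP.σ_pos.ne' hP.R_pos.ne', Params.rateBound]
      have h1 := hF.abs_le hP hx
      have h2 : |x - P.qM| ≤ 3 * |P.qM| + 1 := by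
        have := abs_sub x P.qM; linarith
      have h3 : (x - P.qM) ^ 2 ≤ (3 * |P.qM| + 1) ^ 2 := by
        rw [← sq_abs (x - P.qM)]; gcongr
      have h4 := hP.R_pos
      have h5 : P.gap * P.R * (x - P.qM) ^ 2 ≤ |P.gap| * P.R * (3 * |P.qM| + 1) ^ 2 := by
        gcongr
        exact le_abs_self _
      linarith [le_abs_self P.mM]
    -- As `n` is positive and monotone, it is at most its larger boundary value, and at the
    -- boundaries it equals `m`.
    have h1 : (1 - P.R) * P.qM ≠ 0 :=
      mul_ne_zero (sub_ne_zero.2 hP.R_ne_one.symm) hP.qM_ne_zero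
    rcases lt_or_gt_of_ne h1 with h1 | h1
    · have := hF.mono h1 hq hb hq.2
      exact this.trans (hF.bd_right.trans_le (hm b hb))
    · have := hF.anti h1 ha hq hq.1
      exact this.trans (hF.bd_left.trans_le (hm a ha))

/-! ### From the shadow fraction to the real fraction; expansion of consumption -/

noncomputable section

/-- Shadow data with a point of the real no-transaction region. -/
structure Obs (P : Params) where
  D : ShadowData
  εu : ℝ
  εd : ℝ
  εu_pos : 0 < εu
  εd_pos : 0 < εd
  sol : D.Solves P (1 + εu) (1 + εd)
  p : ℝ
  mem : p ∈ Icc (D.pLow (1 + εu)) (D.pHigh (1 + εd))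

namespace Obs

variable {P : Params}

def ε (x : Obs P) : ℝ := (1 + x.εu) * (1 + x.εd) - 1

theorem ε_eq (x : Obs P) : x.ε = x.εu + x.εd + x.εu * x.εd := by simp only [ε]; ring

theorem ε_pos (x : Obs P) : 0 < x.ε := by
  have := x.εu_pos
  have := x.εd_pos
  rw [ε_eq]; positivity

def h (x : Obs P) : ℝ := x.ε ^ (1 / 3 : ℝ)

theorem h_pos (x : Obs P) : 0 < x.h := Real.rpow_pos_of_pos x.ε_pos _

theorem h_cube (x : Obs P) : x.h ^ 3 = x.ε := by
  rw [h, ← Real.rpow_natCast, ← Real.rpow_mul x.ε_pos.le]; norm_num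

theorem log_sub_le {e : ℝ} (he : 0 ≤ e) : |Real.log (1 + e) - e| ≤ e ^ 2 := by
  have h1 := Real.log_le_sub_one_of_pos (show 0 < 1 + e by linarith)
  have h2 := Real.one_sub_inv_le_log_of_pos (show 0 < 1 + e by linarith)
  have h3 : e - e ^ 2 ≤ 1 - (1 + e)⁻¹ := by
    have : 1 - (1 + e)⁻¹ - (e - e ^ 2) = e ^ 3 * (1 + e)⁻¹ := by
      field_simp; ring
    have : 0 ≤ e ^ 3 * (1 + e)⁻¹ := by positivity
    linarith
  rw [abs_le]
  constructor <;> nlinarith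

/-- The corresponding point of the shadow no-transaction region. -/
def toPt (hP : P.Regular) (x : Obs P) : Pt P where
  h := x.h
  L := Real.log ((1 + x.εu) * (1 + x.εd))
  a := x.D.qLow
  b := x.D.qHigh
  g := excess P x.D.n
  I := fun q => Real.log (1 + x.εu) - Real.log (x.D.κ q)
  G := fun q => -(derivWithin x.D.κ (Icc x.D.qLow x.D.qHigh) q / x.D.κ q)
  red := x.sol.reduced hP (by linarith [x.εu_pos]) (by linarith [x.εd_pos])
  h_pos := x.h_pos
  L_le := by
    have h1 := Real.log_le_sub_one_of_pos (show 0 < (1 + x.εu) * (1 + x.εd) by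
      have := x.εu_pos; have := x.εd_pos; positivity)
    rw [h_cube]; exact h1
  abs_L_sub := by
    have h1 := log_sub_le x.ε_pos.le
    rw [show x.h ^ 6 = (x.h ^ 3) ^ 2 by ring, h_cube]
    rwa [show 1 + x.ε = (1 + x.εu) * (1 + x.εd) by simp only [ε]; ring] at h1
  q := x.D.sf x.p
  mem := x.sol.shadow_fraction.mapsTo x.mem

abbrev O (P : Params) (n : ℕ) (f : Obs P → ℝ) : Prop := IsO Obs.h n f

theorem O.of_pt (hP : P.Regular) {n : ℕ} {f : Pt P → ℝ} (hf : Pt.O P n f) :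
    O P n (fun x => f (x.toPt hP)) :=
  IsO.comp hf (toPt hP)

theorem O_ε : O P 3 (fun x => x.ε) :=
  (IsO.self_pow 3).of_eq fun x => x.h_cube.symm

theorem O_εu : O P 3 (fun x => x.εu) := by
  refine O_ε.of_abs_le 1 (Eventually.of_forall fun x => ?_)
  have h1 := x.εu_pos
  have h2 := x.εd_pos
  rw [abs_of_pos h1, abs_of_pos x.ε_pos, ε_eq]
  nlinarith [mul_pos h1 h2]

theorem O_εd : O P 3 (fun x => x.εd) := by
  refine O_ε.of_abs_le 1 (Eventually.of_forall fun x => ?_)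
  have h1 := x.εu_pos
  have h2 := x.εd_pos
  rw [abs_of_pos h2, abs_of_pos x.ε_pos, ε_eq]
  nlinarith [mul_pos h1 h2]

theorem O_qLow (hP : P.Regular) : O P 1 (fun x => x.D.qLow - P.qM) :=
  ((O.of_pt hP (Pt.O_u hP.R_pos)).const_mul (-1)).of_eq fun x => by
    simp only [Pt.u, toPt]; ring

theorem O_qHigh (hP : P.Regular) : O P 1 (fun x => x.D.qHigh - P.qM) :=
  (O.of_pt hP (Pt.O_v hP.R_pos)).of_eq fun x => by simp only [Pt.v, toPt]

theorem eventually_half_le_abs {f : Obs P → ℝ} {c : ℝ} (hf : O P 1 (fun x => f x - c)) :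
    ∀ᶠ x in comap h (𝓝 0), |c| / 2 ≤ |f x| := by
  by_cases hc : c = 0
  · subst hc; exact Eventually.of_forall fun x => by simp
  have h1 := (hf.tendsto_zero one_ne_zero).abs
  rw [abs_zero] at h1
  filter_upwards [h1.eventually (gt_mem_nhds (half_pos (abs_pos.2 hc)))] with x hx
  have := abs_sub_abs_le_abs_sub c (f x)
  rw [abs_sub_comm] at this
  linarith

/-- A Möbius transformation with parameter near `1` is close to the identity. -/
theorem O_div_sub {z e : Obs P → ℝ} (hz : O P 0 z) (he : O P 3 e) {f : Obs P → ℝ}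
    (hf : ∀ x, 1 + e x ≠ 0 → f x = z x / (1 + e x)) : O P 3 (fun x => f x - z x) := by
  have h1 : O P 1 (fun x => 1 + e x - 1) := (he.mono (by norm_num)).of_eq fun x => by ring
  have h2 := eventually_half_le_abs h1
  rw [abs_one] at h2
  refine (hz.mul he).of_abs_le 2 ?_
  filter_upwards [h2] with x hx
  have h3 : 1 + e x ≠ 0 := by
    intro h0; rw [h0, abs_zero] at hx; norm_num at hx
  have h4 : f x - z x = -(z x * e x) / (1 + e x) := by rw [hf x h3]; field_simp; ring
  rw [h4, abs_div, abs_neg, div_le_iff₀ (by linarith)]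
  nlinarith [abs_nonneg (z x * e x)]

theorem O_pLow (hP : P.Regular) : O P 3 (fun x => x.D.pLow (1 + x.εu) - x.D.qLow) := by
  have ha : O P 0 (fun x => x.D.qLow) :=
    (((O_qLow hP).mono (by norm_num)).add (IsO.const P.qM)).of_eq fun x => by ring
  have hd : O P 3 (fun x => x.εu * (1 - x.D.qLow)) := O_εu.mul ((IsO.const 1).sub ha)
  refine O_div_sub ha hd fun x hx => ?_
  have hu : 1 + x.εu ≠ 0 := by have := x.εu_pos; positivity
  have h2 : 1 + (1 / (1 + x.εu) - 1) * x.D.qLow = (1 + x.εu * (1 - x.D.qLow)) / (1 + x.εu) := by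
    field_simp; ring
  rw [ShadowData.pLow, mobius, h2]
  field_simp

theorem O_pHigh (hP : P.Regular) : O P 3 (fun x => x.D.pHigh (1 + x.εd) - x.D.qHigh) := by
  have hb : O P 0 (fun x => x.D.qHigh) :=
    (((O_qHigh hP).mono (by norm_num)).add (IsO.const P.qM)).of_eq fun x => by ring
  have h1 : O P 3 (fun x => x.D.pHigh (1 + x.εd) - (1 + x.εd) * x.D.qHigh) := by
    refine O_div_sub (e := fun x => x.εd * x.D.qHigh)
      ((((IsO.const 1).add (O_εd.mono (by norm_num))).mul hb)) (O_εd.mul hb) fun x hx => ?_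
    rw [ShadowData.pHigh, mobius]; ring_nf
  exact (h1.add (O_εd.mul hb)).of_eq fun x => by ring

theorem O_p (hP : P.Regular) : O P 1 (fun x => x.p - P.qM) := by
  have h1 : O P 1 (fun x => x.D.pLow (1 + x.εu) - P.qM) :=
    (((O_pLow hP).mono (by norm_num)).add (O_qLow hP)).of_eq fun x => by ring
  have h2 : O P 1 (fun x => x.D.pHigh (1 + x.εd) - P.qM) :=
    (((O_pHigh hP).mono (by norm_num)).add (O_qHigh hP)).of_eq fun x => by ring
  have hs : O P 1 fun x => |x.D.pLow (1 + x.εu) - P.qM| + |x.D.pHigh (1 + x.εd) - P.qM| :=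
    IsBigO.add (IsBigO.abs_left h1) (IsBigO.abs_left h2)
  refine hs.of_abs_le 1 (Eventually.of_forall fun x => ?_)
  obtain ⟨h3, h4⟩ := x.mem
  have h5 := neg_abs_le (x.D.pLow (1 + x.εu) - P.qM)
  have h6 := le_abs_self (x.D.pHigh (1 + x.εd) - P.qM)
  have h7 := abs_nonneg (x.D.pLow (1 + x.εu) - P.qM)
  have h8 := abs_nonneg (x.D.pHigh (1 + x.εd) - P.qM)
  rw [abs_of_nonneg (add_nonneg h7 h8), abs_le]
  constructor <;> linarith

theorem O_q (hP : P.Regular) : O P 1 (fun x => x.D.sf x.p - P.qM) :=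
  O.of_pt hP (Pt.O_s hP.R_pos)

theorem O_mul_one_sub (z : Obs P → ℝ) (hz : O P 1 (fun x => z x - P.qM)) :
    O P 1 (fun x => z x * (1 - z x) - P.A0) := by
  refine ((hz.const_mul (1 - 2 * P.qM)).sub ((hz.pow 2).mono (by norm_num))).of_eq fun x => ?_
  simp only [Params.A0]; ring

/-- The interval of real fractions of wealth. -/
def J (x : Obs P) : Set ℝ := Icc (x.D.pLow (1 + x.εu)) (x.D.pHigh (1 + x.εd))

/-- The equation for the shadow fraction reads `sf' = (q(1-q) - g) / (p(1-p))` with `q = sf p`, and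
numerator and denominator are both `A0 + O(h)`. In particular `p ≠ 1` for small `h`, so the equation
is available. -/
theorem O_slope (hP : P.Regular) :
    O P 1 (fun x => derivWithin x.D.sf x.J x.p - 1) := by
  have hp := O_p hP
  have hAp := O_mul_one_sub _ hp
  have hAq := O_mul_one_sub _ (O_q hP)
  have hA0 := hP.A0_ne
  have hlow := eventually_half_le_abs hAp
  have hg : O P 2 (fun x => excess P x.D.n (x.D.sf x.p)) := O.of_pt hP (Pt.O_g hP)
  have h1 : O P 1 (fun x => (x.D.sf x.p * (1 - x.D.sf x.p) - P.A0) -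
      excess P x.D.n (x.D.sf x.p) - (x.p * (1 - x.p) - P.A0)) :=
    (hAq.sub (hg.mono (by norm_num))).sub hAp
  refine IsO.cancel (k := 0) (g := fun x => x.p * (1 - x.p)) ?_ h_pos
    (half_pos (abs_pos.2 hA0)) (by simpa using hlow)
  refine h1.of_abs_le 1 ?_
  filter_upwards [hlow] with x hx
  have h0 : x.p * (1 - x.p) ≠ 0 := by
    intro h0; rw [h0, abs_zero] at hx
    have := abs_pos.2 hA0; linarith
  have hp1 : x.p ≠ 1 := fun h2 => h0 (by rw [h2]; ring)
  have hgap := hP.gap_ne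
  rw [J, x.sol.shadow_fraction.ode x.p x.mem hp1, P.ell_sub_m, ← gap_mul_sub_excess hP, one_mul]
  apply le_of_eq
  congr 1
  rw [mul_div_mul_left _ _ hgap, sub_mul, div_mul_cancel₀ _ h0]
  ring

/-- The shadow fraction of wealth is close to the fraction of wealth. -/
theorem O_sf_sub (hP : P.Regular) : O P 2 (fun x => x.D.sf x.p - x.p) := by
  obtain ⟨C, hC, δ, hδ, H⟩ := IsO.bound (O_slope hP) h_pos
  have hw : O P 1 (fun x => x.D.pHigh (1 + x.εd) - x.D.pLow (1 + x.εu)) :=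
    (((((O_pHigh hP).mono (by norm_num)).add (O_qHigh hP)).sub
      ((O_pLow hP).mono (by norm_num))).sub (O_qLow hP)).of_eq fun x => by ring
  have hmv : O P 2 (fun x => (x.D.sf x.p - x.p) -
      (x.D.qLow - x.D.pLow (1 + x.εu))) := by
    refine ((IsO.self_pow 1).mul hw).of_abs_le C
      ((IsO.eventually_iff h_pos).2 ⟨δ, hδ, fun x hx => ?_⟩)
    have hd : ∀ p ∈ x.J, HasDerivWithinAt (fun p => x.D.sf p - p) (derivWithin x.D.sf x.J p - 1)
        x.J p := fun p hp =>
      ((x.sol.shadow_fraction.contDiff.differentiableOn one_ne_zero) p hp).hasDerivWithinAt.sub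
        (hasDerivWithinAt_id p _)
    have hb : ∀ p ∈ x.J, ‖derivWithin x.D.sf x.J p - 1‖ ≤ C * x.h ^ 1 := fun p hp =>
      H { x with p := p, mem := hp } hx
    have hl : x.D.pLow (1 + x.εu) ∈ x.J := left_mem_Icc.2 x.sol.lt.le
    have h2 := (convex_Icc _ _).norm_image_sub_le_of_norm_hasDerivWithin_le hd hb hl x.mem
    simp only [x.sol.shadow_fraction.bd_left] at h2
    rw [Real.norm_eq_abs, Real.norm_eq_abs, abs_of_nonneg (sub_nonneg.2 x.mem.1)] at h2
    refine h2.trans ?_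
    have hh := x.h_pos
    have h3 := sub_pos.2 x.sol.lt
    rw [abs_of_pos (by positivity), ← mul_assoc]
    have := x.mem.2
    gcongr
  exact (hmv.sub ((O_pLow hP).mono (by norm_num))).of_eq fun x => by ring

/-- The normalized position in the no-transaction region. -/
def v (x : Obs P) : ℝ := (x.p - P.qM) / (P.δ₀ * x.h)

theorem v_mul (hP : P.Regular) (x : Obs P) : x.v * (P.δ₀ * x.h) = x.p - P.qM :=
  div_mul_cancel₀ _ (mul_pos hP.δ₀_pos x.h_pos).ne'

theorem O_v (hP : P.Regular) : O P 0 (fun x => x.v) := by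
  refine IsO.cancel (k := 1) (g := fun x => P.δ₀ * x.h) ?_ h_pos hP.δ₀_pos
    (Eventually.of_forall fun x => ?_)
  · exact (O_p hP).of_eq fun x => v_mul hP x
  · rw [pow_one]; exact le_abs_self _

theorem O_h3 (hP : P.Regular) : O P 0 (fun x => h3 x.v) := by
  have hv := O_v hP
  exact (((IsO.const 1).add hv).pow 2).mul ((IsO.const 2).sub hv)

/-- The decrease of the logarithm of the relative shadow price. -/
def I (x : Obs P) : ℝ := Real.log (1 + x.εu) - Real.log (x.D.κ (x.D.sf x.p))

theorem O_I (hP : P.Regular) : O P 3 (fun x => x.I) := O.of_pt hP Pt.O_I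

/-- Replacing `s` by `p - qM = v δ₀ h` in `Pt.O_shadow` costs `O(h²) * O(h²)`. The cubic becomes
`(δ₀h)³ (v - v³/3 + 2/3) = (δ₀h)³ h3(v) / 3`, and `w0 R δ₀³ = 3/4`. -/
theorem O_I_sub (hP : P.Regular) : O P 4 (fun x => x.I - x.h ^ 3 * h3 x.v / 4) := by
  have h1 := O.of_pt hP (Pt.O_shadow hP)
  have hp := O_p hP
  have hq := O_q hP
  have hd : O P 1 (fun x => P.δ₀ * x.h) := IsO.self.const_mul P.δ₀
  have hs := O_sf_sub hP
  refine (h1.add (((hs.mul (hd.pow 2)).sub ((hs.mul (((hq.pow 2).add (hq.mul hp)).add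
    (hp.pow 2))).const_mul (1 / 3))).const_mul (P.w0 * P.R))).of_eq fun x => ?_
  have h2 := hP.w0_R_δ₀
  simp only [Pt.Iq, Pt.s, toPt, I]
  rw [← v_mul hP x, h3, show x.D.sf x.p = (x.D.sf x.p - P.qM) + P.qM by ring,
    show x.p = x.v * (P.δ₀ * x.h) + P.qM by rw [v_mul hP]; ring]
  linear_combination (x.h ^ 3 * ((1 + x.v) ^ 2 * (2 - x.v)) / 4) * h2

/-- The relative shadow price. -/
def k (x : Obs P) : ℝ := x.D.κ (x.D.sf x.p)

theorem k_eq (x : Obs P) : x.k = (1 + x.εu) * Real.exp (-x.I) := by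
  have h1 := x.sol.shadow_price.pos _ (x.sol.shadow_fraction.mapsTo x.mem)
  have h2 : 0 < 1 + x.εu := by linarith [x.εu_pos]
  rw [I, neg_sub, Real.exp_sub, Real.exp_log h1, Real.exp_log h2, k]
  field_simp

theorem O_k (hP : P.Regular) : O P 6 (fun x => x.k - 1 - (x.εu - x.I)) := by
  have hI := O_I hP
  have hr : O P 6 (fun x => Real.exp (-x.I) - 1 - -x.I) := by
    refine (hI.pow 2).of_abs_le 1 ?_
    have h1 := (hI.tendsto_zero (by norm_num)).abs
    rw [abs_zero] at h1
    filter_upwards [h1.eventually (gt_mem_nhds one_pos)] with x hx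
    have := Real.abs_exp_sub_one_sub_id_le (x := -x.I) (by rw [abs_neg]; exact hx.le)
    rw [one_mul, abs_of_nonneg (sq_nonneg x.I)]
    simpa using this
  refine ((((IsO.const 1).add (O_εu.mono (by norm_num))).mul hr).sub (O_εu.mul hI)).of_eq
    fun x => ?_
  rw [k_eq]; ring

/-- Optimal consumption per unit of wealth. -/
def ratio (x : Obs P) : ℝ := (1 + x.p * (x.k - 1)) * x.D.n (x.D.sf x.p)

theorem gap_mul_B (hP : P.Regular) : P.gap * P.B = (1 / P.S - 1) * (P.mM * P.qM) := by
  have h1 := hP.σ_pos.ne'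
  have h2 := hP.S_pos.ne'
  simp only [Params.gap, Params.B]
  field_simp

/-- At order `h³`, `n` contributes `mM qM (1/S - 1)(h³/2 - I)` and the shadow wealth `mM qM (εu -
I)`. Their sum is `mM qM ((h³/2 - I)/S + εu - h³/2)`, where `h³ = ε` is `εu + εd` up to `O(h⁶)` and
`I` is `h³ h3(v)/4` up to `O(h⁴)`. -/
theorem O_ratio (hP : P.Regular) : O P 4 (fun x => x.ratio - (P.mM + P.gap * P.R * (P.δ₀ * x.h) ^ 2
    + P.mM * (P.qM / (2 * P.S) * (1 - 1 / 2 * h3 x.v) * (x.εu + x.εd)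
      + P.qM / 2 * (x.εu - x.εd)))) := by
  have hn1 : O P 2 (fun x => x.D.n (x.D.sf x.p) - P.mM) :=
    (O.of_pt hP (Pt.O_n hP)).of_eq fun x => by
      simp only [Pt.nq, toPt]; rw [rate_excess hP]
  have hn2 := O.of_pt hP (Pt.O_rate hP)
  have hn0 : O P 0 (fun x => x.D.n (x.D.sf x.p)) :=
    ((hn1.mono (by norm_num)).add (IsO.const P.mM)).of_eq fun x => by ring
  have hk := O_k hP
  have hk1 : O P 3 (fun x => x.k - 1) :=
    ((hk.mono (by norm_num)).add (O_εu.sub (O_I hP))).of_eq fun x => by ring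
  have e1 : O P 4 (fun x => x.p * (x.k - 1) * x.D.n (x.D.sf x.p)
      - P.qM * P.mM * (x.εu - x.I)) := by
    refine (((((O_p hP).mul hk1).mul hn0).add (((hk1.mul hn1).mono (k := 4)
      (by norm_num)).const_mul P.qM)).add ((hk.mono (k := 4) (by norm_num)).const_mul
      (P.qM * P.mM))).of_eq fun x => ?_
    ring
  have e2 : O P 4 (fun x => x.εu * x.εd * (1 - 1 / 2 * h3 x.v)) :=
    ((O_εu.mul O_εd).mul ((IsO.const 1).sub ((O_h3 hP).const_mul (1 / 2)))).mono (by norm_num)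
  have e3 : O P 4 (fun x => x.εu * x.εd) := (O_εu.mul O_εd).mono (by norm_num)
  refine (((hn2.add e1).sub ((O_I_sub hP).const_mul (P.mM * P.qM / P.S))).add
    ((e2.const_mul (P.mM * P.qM / (2 * P.S))).sub (e3.const_mul (P.mM * P.qM / 2)))).of_eq
    fun x => ?_
  have h2 := hP.S_pos.ne'
  simp only [Pt.nq, Pt.Iq, toPt]
  rw [rate_excess hP, gap_mul_B hP, ratio, h_cube, ε_eq, ← I]
  field_simp
  ring

/-- The cube root of the sum of the two transaction cost rates. -/
def h' (x : Obs P) : ℝ := (x.εu + x.εd) ^ (1 / 3 : ℝ)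

theorem sum_pos (x : Obs P) : 0 < x.εu + x.εd := add_pos x.εu_pos x.εd_pos

/-- `h³ - h'³ = εu * εd = O(h⁶)`, so the leading term may use `εu + εd` in place of `ε`. -/
theorem O_h'_sq : O P 4 (fun x => x.h ^ 2 - x.h' ^ 2) := by
  have hpos : ∀ x : Obs P, 0 < x.h' := fun x => Real.rpow_pos_of_pos x.sum_pos _
  have hcube : ∀ x : Obs P, x.h' ^ 3 = x.εu + x.εd := fun x => by
    rw [h', ← Real.rpow_natCast, ← Real.rpow_mul x.sum_pos.le]; norm_num
  have hle : ∀ x : Obs P, x.h' ≤ x.h := fun x => by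
    have h1 := mul_pos x.εu_pos x.εd_pos
    refine Real.rpow_le_rpow x.sum_pos.le ?_ (by norm_num)
    rw [ε_eq]; linarith
  have h1 : O P 1 (fun x => x.h') := IsO.self.of_abs_le 1 (Eventually.of_forall fun x => by
    rw [one_mul, abs_of_pos (hpos x), abs_of_pos x.h_pos]; exact hle x)
  have h2 : O P 4 (fun x => x.h - x.h') := by
    refine IsO.cancel (k := 2) (g := fun x => x.h ^ 2 + x.h * x.h' + x.h' ^ 2) (c := 1) ?_ h_pos
      one_pos (Eventually.of_forall fun x => ?_)
    · refine (O_εu.mul O_εd).of_eq fun x => ?_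
      linear_combination x.h_cube - hcube x + x.ε_eq
    · have := hpos x
      have := x.h_pos
      rw [abs_of_pos (by positivity)]
      nlinarith [mul_pos x.h_pos (hpos x), sq_nonneg x.h']
  exact ((h2.mul (IsO.self.add h1)).mono (by norm_num)).of_eq fun x => by ring

theorem O_ratio' (hP : P.Regular) : O P 4 (fun x => x.ratio - (P.mM
    + P.gap * P.R * (P.δ₀ * x.h') ^ 2
    + P.mM * (P.qM / (2 * P.S) * (1 - 1 / 2 * h3 x.v) * (x.εu + x.εd)
      + P.qM / 2 * (x.εu - x.εd)))) :=
  ((O_ratio hP).add (O_h'_sq.const_mul (P.gap * P.R * P.δ₀ ^ 2))).of_eq fun x => by ring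

end Obs

/-- The liquidation value is positive and never exceeds the wealth at the quoted price. -/
theorem Solvent.wealth_pos {γu γd x y φ : ℝ} (hu : 1 ≤ γu) (hd : 1 ≤ γd)
    (h : Solvent γu γd x y φ) : 0 < x + y * φ := by
  obtain ⟨hy, h⟩ := h
  rcases le_total 0 φ with h0 | h0
  · rw [max_eq_left h0, max_eq_right (by linarith), mul_zero, zero_mul, sub_zero] at h
    have h1 : 1 / γd ≤ 1 := by rw [div_le_one (by linarith)]; exact hd
    have h2 : 1 / γd * (φ * y) ≤ 1 * (φ * y) := mul_le_mul_of_nonneg_right h1 (by positivity)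
    linarith
  · rw [max_eq_right h0, max_eq_left (by linarith), mul_zero, zero_mul, add_zero] at h
    have h1 : 0 ≤ (-φ) * y := mul_nonneg (by linarith) hy.le
    nlinarith

/-- Uniform expansion of the optimal consumption. -/
theorem exists_consumption_expansion {P : Params} (hP : P.Regular) :
    ∃ ε₀ : ℝ, 0 < ε₀ ∧ ∃ K : ℝ, ∀ εu εd : ℝ, 0 < εu → εu < ε₀ → 0 < εd → εd < ε₀ →
      ∀ D : ShadowData, D.Solves P (1 + εu) (1 + εd) →
      ∀ ε : ℝ, ε = (1 + εu) * (1 + εd) - 1 →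
      ∀ t x y φ p : ℝ, Solvent (1 + εu) (1 + εd) x y φ →
        p = frac x y φ → p ∈ Icc (D.pLow (1 + εu)) (D.pHigh (1 + εd)) →
        |D.consumption t x y φ - (x + y * φ) * (P.mM + P.gap * P.R
            * P.Delta ^ (2 / 3 : ℝ) * (εu + εd) ^ (2 / 3 : ℝ)
            + P.mM * (P.qM / (2 * P.S) * (1 - 1 / 2 *
              h3 ((p - P.qM) / (P.Delta ^ (1 / 3 : ℝ) * ε ^ (1 / 3 : ℝ)))) * (εu + εd)
            + P.qM / 2 * (εu - εd)))| ≤ K * (x + y * φ) * ε ^ (4 / 3 : ℝ) := by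
  obtain ⟨C, hC, δ, hδ, H⟩ := IsO.bound (Obs.O_ratio' hP) Obs.h_pos
  -- With both rates below `1` and `δ³/3`, each of `εu`, `εd` and `εu * εd` is below `δ³/3`, so `h³
  -- = ε < δ³`.
  refine ⟨min 1 (δ ^ 3 / 3), by positivity, C, ?_⟩
  intro εu εd hu hu' hd hd' D hD ε hε t x y φ p hs hp hpm
  let o : Obs P := ⟨D, εu, εd, hu, hd, hD, p, hpm⟩
  have hoε : o.ε = ε := hε.symm
  have hu1 := hu'.trans_le (min_le_left _ _)
  have hu2 := hu'.trans_le (min_le_right _ _)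
  have hd2 := hd'.trans_le (min_le_right _ _)
  have hoh : o.h < δ := by
    refine lt_of_pow_lt_pow_left₀ 3 hδ.le ?_
    rw [o.h_cube, o.ε_eq]
    change εu + εd + εu * εd < δ ^ 3
    nlinarith
  have h1 := H o hoh
  have hw := hs.wealth_pos (by linarith) (by linarith)
  have hε0 : 0 < ε := hoε ▸ o.ε_pos
  have e1 : o.h ^ 4 = ε ^ (4 / 3 : ℝ) := by
    rw [Obs.h, hoε, ← Real.rpow_natCast, ← Real.rpow_mul hε0.le]; norm_num
  have e2 : (P.δ₀ * o.h') ^ 2 = P.Delta ^ (2 / 3 : ℝ) * (εu + εd) ^ (2 / 3 : ℝ) := by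
    rw [mul_pow, Params.δ₀, Obs.h', ← Real.rpow_natCast, ← Real.rpow_mul hP.Delta_pos.le,
      ← Real.rpow_natCast, ← Real.rpow_mul o.sum_pos.le]
    norm_num [o]
  have e3 : o.v = (p - P.qM) / (P.Delta ^ (1 / 3 : ℝ) * ε ^ (1 / 3 : ℝ)) := by
    rw [Obs.v, Params.δ₀, Obs.h, hoε]
  have e4 : D.consumption t x y φ = (x + y * φ) * o.ratio := by
    rw [ShadowData.consumption, ← hp, Obs.ratio, Obs.k]
    have h2 : y * φ = (x + y * φ) * p := by rw [hp, frac]; field_simp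
    change _ = (x + y * φ) * ((1 + p * (D.κ (D.sf p) - 1)) * D.n (D.sf p))
    linear_combination (D.κ (D.sf p) - 1) * D.n (D.sf p) * h2
  rw [e1, e2, e3] at h1
  rw [e4, ← mul_sub, abs_mul, abs_of_pos hw]
  calc (x + y * φ) * _ ≤ (x + y * φ) * (C * ε ^ (4 / 3 : ℝ)) := by
        refine mul_le_mul_of_nonneg_left (le_of_eq_of_le ?_ h1) hw.le
        simp only [o, mul_assoc]
    _ = _ := by ring

end

/-! ### Excursions of a scalar differential equation -/

/-- Local flow of a `C¹` scalar time dependent vector field, confined to a given neighbourhood. -/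
theorem exists_flow {c : ℝ} {f : ℝ × ℝ → ℝ} (hf : ContDiffAt ℝ 1 f (c, 0)) {U : Set (ℝ × ℝ)}
    (hU : U ∈ 𝓝 (c, 0)) : ∃ τ > 0, ∃ z₀ > 0, ∃ α : ℝ × ℝ → ℝ,
      (∀ z ∈ Icc (-z₀) z₀, α (z, c) = z ∧ ∀ t ∈ Icc (c - τ) (c + τ),
        HasDerivWithinAt (fun t => α (z, t)) (f (t, α (z, t))) (Icc (c - τ) (c + τ)) t ∧
        (t, α (z, t)) ∈ U) ∧
      ContinuousOn α (Icc (-z₀) z₀ ×ˢ Icc (c - τ) (c + τ)) := by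
  obtain ⟨K, V, hV, hK⟩ := hf.exists_lipschitzOnWith
  have hb : ∀ᶠ y in 𝓝 ((c, 0) : ℝ × ℝ), |f y| < |f (c, 0)| + 1 :=
    hf.continuousAt.abs.eventually (gt_mem_nhds (lt_add_one _))
  obtain ⟨e, he, hball⟩ := Metric.mem_nhds_iff.1 (inter_mem hV hb)
  set M : ℝ := |f (c, 0)| + 1 with hM
  have hM0 : 0 < M := by positivity
  set ρ : ℝ := e / 2 with hρ
  have hρ0 : 0 < ρ := half_pos he
  -- Initial values range over radius `ρ/2` and solutions must stay within `ρ`, so Picard–Lindelöf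
  -- requires `M * T ≤ ρ/2`.
  set T : ℝ := min ρ (ρ / (2 * M)) with hT
  have hT0 : 0 < T := by positivity
  have hin : ∀ t ∈ Icc (c - T) (c + T), ∀ z ∈ Metric.closedBall (0 : ℝ) ρ,
      (t, z) ∈ Metric.ball ((c, 0) : ℝ × ℝ) e := by
    intro t ht z hz
    have h1 : T ≤ ρ := min_le_left _ _
    have h2 : |t - c| ≤ ρ := by
      rw [abs_le]; constructor <;> linarith [ht.1, ht.2]
    rw [Metric.mem_closedBall] at hz
    rw [Metric.mem_ball, Prod.dist_eq]
    refine max_lt ?_ ?_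
    · rw [Real.dist_eq]; change |t - c| < e; linarith
    · change dist z 0 < e; linarith
  have hPL : IsPicardLindelof (fun t z => f (t, z)) (tmin := c - T) (tmax := c + T)
      ⟨c, by constructor <;> linarith⟩ (0 : ℝ) ⟨ρ, hρ0.le⟩ ⟨ρ / 2, by positivity⟩ ⟨M, hM0.le⟩ K := by
    refine ⟨fun t ht => ?_, fun z hz => ?_, fun t ht z hz => ?_, ?_⟩
    · refine LipschitzOnWith.of_dist_le_mul fun z hz z' hz' => ?_
      have := hK.dist_le_mul _ (hball (hin t ht z hz)).1 _ (hball (hin t ht z' hz')).1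
      simpa [Prod.dist_eq] using this
    · refine hK.continuousOn.comp (by fun_prop) fun t ht => (hball (hin t ht z hz)).1
    · exact (hball (hin t ht z hz)).2.le
    · change M * max (c + T - c) (c - (c - T)) ≤ ρ - ρ / 2
      rw [add_sub_cancel_left, sub_sub_cancel, max_self]
      calc M * T ≤ M * (ρ / (2 * M)) := by gcongr; exact min_le_right _ _
        _ = ρ - ρ / 2 := by field_simp; ring
  obtain ⟨α, hα, hc⟩ := hPL.exists_forall_mem_closedBall_eq_hasDerivWithinAt_continuousOn
  have hα0 : α (0, c) = 0 := (hα 0 (Metric.mem_closedBall_self (half_pos hρ0).le)).1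
  have h00 : ((0, c) : ℝ × ℝ) ∈ Metric.closedBall (0 : ℝ) (ρ / 2) ×ˢ Icc (c - T) (c + T) :=
    ⟨Metric.mem_closedBall_self (half_pos hρ0).le, by constructor <;> linarith⟩
  have hcU : ∀ᶠ y in 𝓝[Metric.closedBall (0 : ℝ) (ρ / 2) ×ˢ Icc (c - T) (c + T)] (0, c),
      (y.2, α y) ∈ U := by
    have h1 : ContinuousWithinAt (fun y : ℝ × ℝ => (y.2, α y))
        (Metric.closedBall (0 : ℝ) (ρ / 2) ×ˢ Icc (c - T) (c + T)) (0, c) :=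
      continuousWithinAt_snd.prodMk (hc _ h00)
    refine h1 ?_
    change U ∈ 𝓝 (c, α (0, c))
    rwa [hα0]
  rw [eventually_nhdsWithin_iff, Metric.eventually_nhds_iff] at hcU
  obtain ⟨d, hd, hdU⟩ := hcU
  have hsub1 : Icc (-min (ρ / 2) (d / 2)) (min (ρ / 2) (d / 2)) ⊆
      Metric.closedBall (0 : ℝ) (ρ / 2) := by
    intro z hz
    rw [Metric.mem_closedBall, Real.dist_eq, sub_zero, abs_le]
    have := min_le_left (ρ / 2) (d / 2)
    constructor <;> linarith [hz.1, hz.2]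
  have hsub2 : Icc (c - min T (d / 2)) (c + min T (d / 2)) ⊆ Icc (c - T) (c + T) := by
    have := min_le_left T (d / 2)
    exact Icc_subset_Icc (by linarith) (by linarith)
  refine ⟨min T (d / 2), by positivity, min (ρ / 2) (d / 2), by positivity, α,
    fun z hz => ⟨(hα z (hsub1 hz)).1, fun t ht => ⟨?_, ?_⟩⟩, hc.mono (prod_mono hsub1 hsub2)⟩
  · exact ((hα z (hsub1 hz)).2 t (hsub2 ht)).mono hsub2
  · refine hdU (y := (z, t)) ?_ ⟨hsub1 hz, hsub2 ht⟩
    rw [Prod.dist_eq]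
    have h1 := min_le_right (ρ / 2) (d / 2)
    have h2 := min_le_right T (d / 2)
    refine max_lt ?_ ?_
    · change dist z 0 < d
      have : |z - 0| ≤ d / 2 := by rw [abs_le]; constructor <;> linarith [hz.1, hz.2]
      rw [Real.dist_eq]; linarith
    · change dist t c < d
      have : |t - c| ≤ d / 2 := by rw [abs_le]; constructor <;> linarith [ht.1, ht.2]
      rw [Real.dist_eq]; linarith

/-- A linear equation with a forcing term that changes sign once has unimodal solutions, up to an
integrating factor. -/
theorem exists_integrating_factor {c R τ : ℝ} (hR : 0 < R) (hτ : 0 < τ) {g H : ℝ → ℝ}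
    (hH : ContinuousOn H (Icc (c - τ) (c + τ)))
    (hg : ∀ t ∈ Icc (c - τ) (c + τ),
      HasDerivWithinAt g (-(2 * R * (t - c)) - g t * H t) (Icc (c - τ) (c + τ)) t) :
    ∃ E : ℝ → ℝ, (∀ t, 0 < E t) ∧ StrictMonoOn (fun t => g t * E t) (Icc (c - τ) c) ∧
      StrictAntiOn (fun t => g t * E t) (Icc c (c + τ)) := by
  -- `H` is extended by constants so that `E = exp ∫ H` is differentiable on the whole line; then
  -- `(g E)' = -2R(t - c) E`.
  have hle : c - τ ≤ c + τ := by linarith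
  set Hx : ℝ → ℝ := IccExtend hle ((Icc (c - τ) (c + τ)).domRestrict H) with hHx
  have hHc : Continuous Hx := (continuousOn_iff_continuous_domRestrict.1 hH).Icc_extend'
  set E : ℝ → ℝ := fun t => Real.exp (∫ x in c..t, Hx x) with hE
  have hEd : ∀ t, HasDerivAt E (E t * Hx t) t := fun t =>
    (intervalIntegral.integral_hasDerivAt_right (hHc.intervalIntegrable _ _)
      (hHc.stronglyMeasurableAtFilter _ _) hHc.continuousAt).exp
  have hE0 : ∀ t, 0 < E t := fun t => Real.exp_pos _
  have hd : ∀ t ∈ Icc (c - τ) (c + τ), HasDerivWithinAt (fun t => g t * E t)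
      (-(2 * R * (t - c)) * E t) (Icc (c - τ) (c + τ)) t := fun t ht => by
    refine ((hg t ht).mul (hEd t).hasDerivWithinAt).congr_deriv ?_
    rw [show Hx t = H t from IccExtend_of_mem _ _ ht]
    ring
  have hs1 : Icc (c - τ) c ⊆ Icc (c - τ) (c + τ) := Icc_subset_Icc le_rfl (by linarith)
  have hs2 : Icc c (c + τ) ⊆ Icc (c - τ) (c + τ) := Icc_subset_Icc (by linarith) le_rfl
  refine ⟨E, hE0, ?_, ?_⟩
  · refine strictMonoOn_of_hasDerivWithinAt_pos (convex_Icc _ _)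
      (f' := fun t => -(2 * R * (t - c)) * E t)
      (fun t ht => ((hd t (hs1 ht)).mono hs1).continuousWithinAt)
      (fun t ht => (hd t (hs1 (interior_subset ht))).mono (interior_subset.trans hs1)) ?_
    intro t ht
    rw [interior_Icc] at ht
    have := hE0 t
    have : 0 < c - t := sub_pos.2 ht.2
    have h3 : -(2 * R * (t - c)) * E t = 2 * R * (c - t) * E t := by ring
    simp only [h3]
    positivity
  · refine strictAntiOn_of_hasDerivWithinAt_neg (convex_Icc _ _)
      (f' := fun t => -(2 * R * (t - c)) * E t)
      (fun t ht => ((hd t (hs2 ht)).mono hs2).continuousWithinAt)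
      (fun t ht => (hd t (hs2 (interior_subset ht))).mono (interior_subset.trans hs2)) ?_
    intro t ht
    rw [interior_Icc] at ht
    have := hE0 t
    have : 0 < t - c := sub_pos.2 ht.1
    have h3 : -(2 * R * (t - c)) * E t = -(2 * R * (t - c) * E t) := by ring
    simp only [h3, neg_neg_iff_pos]
    positivity

/-- Positive excursions of the solutions of `g' = -2 R (t - c) - g H(t, g)` around `c` realize all
small values of the weighted integral `∫ g w(t, g)`. -/
theorem exists_excursion {c R : ℝ} (hR : 0 < R) {H w : ℝ × ℝ → ℝ} (hH : ContDiffAt ℝ 1 H (c, 0))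
    {U : Set (ℝ × ℝ)} (hU : U ∈ 𝓝 (c, 0)) (hHc : ContinuousOn H U) (hw : ContinuousOn w U)
    (hw0 : ∀ y ∈ U, 0 < w y) : ∃ L₀ > 0, ∀ L, 0 < L → L < L₀ → ∃ (a b : ℝ) (g : ℝ → ℝ),
      a < c ∧ c < b ∧ (∀ t ∈ Icc a b, (t, g t) ∈ U) ∧
      (∀ t ∈ Icc a b,
        HasDerivWithinAt g (-(2 * R * (t - c)) - g t * H (t, g t)) (Icc a b) t) ∧
      g a = 0 ∧ g b = 0 ∧ (∀ t ∈ Ioo a b, 0 < g t) ∧ ∫ t in a..b, g t * w (t, g t) = L := by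
  obtain ⟨τ, hτ, z₀, hz₀, α, hα, hαc⟩ := exists_flow
    (f := fun y => -(2 * R * (y.1 - c)) - y.2 * H y) (by fun_prop) hU
  set T := Icc (c - τ) (c + τ) with hT
  have hcT : c ∈ T := by constructor <;> linarith
  have hlT : c - τ ∈ T := by constructor <;> linarith
  have hrT : c + τ ∈ T := by constructor <;> linarith
  have hgc : ∀ z ∈ Icc (-z₀) z₀, ContinuousOn (fun t => α (z, t)) T := fun z hz t ht =>
    ((hα z hz).2 t ht).1.continuousWithinAt
  have hmaps : ∀ z ∈ Icc (-z₀) z₀, MapsTo (fun t => (t, α (z, t))) T U := fun z hz t ht =>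
    ((hα z hz).2 t ht).2
  have hpair : ∀ z ∈ Icc (-z₀) z₀, ContinuousOn (fun t => (t, α (z, t))) T := fun z hz =>
    continuousOn_id.prodMk (hgc z hz)
  have hint : ∀ z ∈ Icc (-z₀) z₀, ∃ E : ℝ → ℝ, (∀ t, 0 < E t) ∧
      StrictMonoOn (fun t => α (z, t) * E t) (Icc (c - τ) c) ∧
      StrictAntiOn (fun t => α (z, t) * E t) (Icc c (c + τ)) := fun z hz =>
    exists_integrating_factor hR hτ (H := fun t => H (t, α (z, t)))
      (hHc.comp (hpair z hz) (hmaps z hz)) fun t ht => ((hα z hz).2 t ht).1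
  have hcl : c ∈ Icc (c - τ) c := right_mem_Icc.2 (by linarith)
  have hcr : c ∈ Icc c (c + τ) := left_mem_Icc.2 (by linarith)
  -- the solution through `0`
  have h0mem : (0 : ℝ) ∈ Icc (-z₀) z₀ := by constructor <;> linarith
  have hzero : ∀ t ∈ T, t ≠ c → α (0, t) < 0 := by
    intro t ht htc
    obtain ⟨E, hE0, hm, ha⟩ := hint 0 h0mem
    have h1 : α (0, t) * E t < 0 := by
      have h0 : α (0, c) * E c = 0 := by rw [(hα 0 h0mem).1, zero_mul]
      rcases lt_or_gt_of_ne htc with h | h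
      · have := hm ⟨ht.1, h.le⟩ hcl h
        simpa only [h0] using this
      · have := ha hcr ⟨h.le, ht.2⟩ h
        simpa only [h0] using this
    by_contra h2
    exact absurd (mul_nonneg (not_lt.1 h2) (hE0 t).le) (not_le.2 h1)
  have hzc : ∀ t ∈ T, ContinuousOn (fun z => α (z, t)) (Icc (-z₀) z₀) := fun t ht =>
    hαc.comp (by fun_prop) fun z hz => ⟨hz, ht⟩
  have hneg : ∀ t ∈ T, t ≠ c → ∀ᶠ z in 𝓝 (0 : ℝ), α (z, t) < 0 := fun t ht htc => by
    have h1 : ContinuousAt (fun z => α (z, t)) 0 :=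
      (hzc t ht).continuousAt (Icc_mem_nhds (by linarith) hz₀)
    exact h1.eventually (gt_mem_nhds (hzero t ht htc))
  -- The solution through `0` is negative at both ends of the time interval. By continuity so are
  -- those of small height `z`, whose excursions thus end inside the interval.
  obtain ⟨d, hd, hdn⟩ := Metric.eventually_nhds_iff.1
    ((hneg _ hlT (by linarith)).and (hneg _ hrT (by linarith)))
  set z₁ := min z₀ (d / 2) with hz₁
  have hz₁0 : 0 < z₁ := by positivity
  have hz₁le : z₁ ≤ z₀ := min_le_left _ _
  have hsubz : Icc 0 z₁ ⊆ Icc (-z₀) z₀ := Icc_subset_Icc (by linarith) hz₁le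
  have hends : ∀ z ∈ Icc 0 z₁, α (z, c - τ) < 0 ∧ α (z, c + τ) < 0 := fun z hz => by
    refine hdn ?_
    have : z₁ ≤ d / 2 := min_le_right _ _
    rw [Real.dist_eq, sub_zero, abs_of_nonneg hz.1]; linarith [hz.2]
  -- the weighted integral as a continuous function of the initial value
  set φ : ℝ → ℝ → ℝ := fun z t => max (α (z, t)) 0 * w (t, α (z, t)) with hφ
  -- Clamping both variables makes the integrand continuous on the whole plane, so continuity of
  -- parametric integrals applies.
  set pz : ℝ → ℝ := fun z => max 0 (min z z₁) with hpz
  set pt : ℝ → ℝ := fun t => max (c - τ) (min t (c + τ)) with hpt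
  have hpz_mem : ∀ z, pz z ∈ Icc 0 z₁ := fun z =>
    ⟨le_max_left _ _, max_le hz₁0.le (min_le_right _ _)⟩
  have hpt_mem : ∀ t, pt t ∈ T := fun t =>
    ⟨le_max_left _ _, max_le (by linarith) (min_le_right _ _)⟩
  have hpz_id : ∀ z ∈ Icc 0 z₁, pz z = z := fun z hz => by
    simp only [hpz, min_eq_left hz.2, max_eq_right hz.1]
  have hpt_id : ∀ t ∈ T, pt t = t := fun t ht => by
    simp only [hpt, min_eq_left ht.2, max_eq_right ht.1]
  have hpzc : Continuous pz := by fun_prop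
  have hptc : Continuous pt := by fun_prop
  have hαcont : Continuous fun y : ℝ × ℝ => α (pz y.1, pt y.2) :=
    hαc.comp_continuous (by fun_prop) fun y => ⟨hsubz (hpz_mem _), hpt_mem _⟩
  have hwcont : Continuous fun y : ℝ × ℝ => w (pt y.2, α (pz y.1, pt y.2)) :=
    hw.comp_continuous ((hptc.comp continuous_snd).prodMk hαcont) fun y =>
      hmaps _ (hsubz (hpz_mem _)) (hpt_mem _)
  have hΦcont : Continuous fun z => ∫ t in (c - τ)..(c + τ), φ (pz z) (pt t) :=
    intervalIntegral.continuous_parametric_intervalIntegral_of_continuous'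
      (f := fun z t => φ (pz z) (pt t)) ((hαcont.max continuous_const).mul hwcont) _ _
  have hle : c - τ ≤ c + τ := by linarith
  have hΦ : ∀ z ∈ Icc 0 z₁, ∫ t in (c - τ)..(c + τ), φ (pz z) (pt t) =
      ∫ t in (c - τ)..(c + τ), φ z t := fun z hz => by
    refine intervalIntegral.integral_congr fun t ht => ?_
    rw [uIcc_of_le hle] at ht
    simp only [hpz_id z hz, hpt_id t ht]
  have hφc : ∀ z ∈ Icc 0 z₁, ContinuousOn (φ z) T := fun z hz =>
    ((hgc z (hsubz hz)).sup continuousOn_const).mul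
      (hw.comp (hpair z (hsubz hz)) (hmaps z (hsubz hz)))
  have h0z : (0 : ℝ) ∈ Icc 0 z₁ := left_mem_Icc.2 hz₁0.le
  have h1z : z₁ ∈ Icc 0 z₁ := right_mem_Icc.2 hz₁0.le
  have hΦ0 : ∫ t in (c - τ)..(c + τ), φ 0 t = 0 := by
    refine (intervalIntegral.integral_congr fun t ht => ?_).trans
      intervalIntegral.integral_zero
    rw [uIcc_of_le hle] at ht
    have : α (0, t) ≤ 0 := by
      by_cases h : t = c
      · rw [h, (hα 0 h0mem).1]
      · exact (hzero t ht h).le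
    simp only [hφ, max_eq_right this, zero_mul]
  have hΦ1 : 0 < ∫ t in (c - τ)..(c + τ), φ z₁ t := by
    refine intervalIntegral.integral_pos (by linarith) (hφc z₁ h1z) (fun t ht => ?_) ⟨c, hcT, ?_⟩
    · exact mul_nonneg (le_max_right _ _)
        (hw0 _ (hmaps z₁ (hsubz h1z) (Ioc_subset_Icc_self ht))).le
    · refine mul_pos ?_ (hw0 _ (hmaps z₁ (hsubz h1z) hcT))
      rw [(hα z₁ (hsubz h1z)).1]; exact lt_max_of_lt_left hz₁0
  refine ⟨_, hΦ1, fun L hL hL1 => ?_⟩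
  obtain ⟨z, hz, hzL⟩ := intermediate_value_Icc hz₁0.le hΦcont.continuousOn
    (show L ∈ Icc _ _ by
      simp only [hΦ 0 h0z, hΦ z₁ h1z, hΦ0]; exact ⟨hL.le, hL1.le⟩)
  simp only [hΦ z hz] at hzL
  have hzpos : 0 < z := by
    rcases hz.1.eq_or_lt with h | h
    · rw [← h, hΦ0] at hzL; exact absurd hzL hL.ne
    · exact h
  set g : ℝ → ℝ := fun t => α (z, t) with hg
  have hgT : ContinuousOn g T := hgc z (hsubz hz)
  have hgcz : g c = z := (hα z (hsubz hz)).1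
  obtain ⟨E, hE0, hmono, hanti⟩ := hint z (hsubz hz)
  have hs1 : Icc (c - τ) c ⊆ T := Icc_subset_Icc le_rfl (by linarith)
  have hs2 : Icc c (c + τ) ⊆ T := Icc_subset_Icc (by linarith) le_rfl
  obtain ⟨a, ha, hga⟩ := intermediate_value_Icc (by linarith : c - τ ≤ c) (hgT.mono hs1)
    (show (0 : ℝ) ∈ Icc _ _ from ⟨(hends z hz).1.le, by rw [hgcz]; exact hz.1⟩)
  obtain ⟨b, hb, hgb⟩ := intermediate_value_Icc' (by linarith : c ≤ c + τ) (hgT.mono hs2)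
    (show (0 : ℝ) ∈ Icc _ _ from ⟨(hends z hz).2.le, by rw [hgcz]; exact hz.1⟩)
  have hac : a < c := by
    refine ha.2.lt_of_ne fun h => ?_
    rw [h, hgcz] at hga; exact hzpos.ne' hga
  have hcb : c < b := by
    refine hb.1.lt_of_ne fun h => ?_
    rw [← h, hgcz] at hgb; exact hzpos.ne' hgb
  have hsub : Icc a b ⊆ T := Icc_subset_Icc ha.1 hb.2
  have hga' : g a * E a = 0 := by rw [hga, zero_mul]
  have hgb' : g b * E b = 0 := by rw [hgb, zero_mul]
  have hpos : ∀ t ∈ Ioo a b, 0 < g t := by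
    intro t ht
    have h1 : 0 < g t * E t := by
      rcases le_total t c with h | h
      · rw [← hga']; exact hmono ha ⟨ha.1.trans ht.1.le, h⟩ ht.1
      · rw [← hgb']; exact hanti ⟨h, ht.2.le.trans hb.2⟩ hb ht.2
    exact pos_of_mul_pos_left h1 (hE0 t).le
  -- Outside the excursion the positive part in `φ` vanishes, so the integral over the fixed
  -- interval is the integral over `[a, b]`.
  have hout : ∀ t ∈ T, t ∉ Ioo a b → g t ≤ 0 := by
    intro t ht hn
    have h1 : g t * E t ≤ 0 := by
      rcases le_total t c with h | h
      · have h2 : t ≤ a := by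
          by_contra h3
          exact hn ⟨not_le.1 h3, h.trans_lt hcb⟩
        rw [← hga']; exact hmono.monotoneOn ⟨ht.1, h⟩ ha h2
      · have h2 : b ≤ t := by
          by_contra h3
          exact hn ⟨hac.trans_le h, not_le.1 h3⟩
        rw [← hgb']; exact hanti.antitoneOn hb ⟨h, ht.2⟩ h2
    by_contra h2
    exact absurd (mul_pos (not_le.1 h2) (hE0 t)) (not_lt.2 h1)
  refine ⟨a, b, g, hac, hcb, fun t ht => hmaps z (hsubz hz) (hsub ht), fun t ht =>
    ((hα z (hsubz hz)).2 t (hsub ht)).1.mono hsub, hga, hgb, hpos, ?_⟩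
  have hab : a ≤ b := (hac.trans hcb).le
  have hφi : ∀ {s t : ℝ}, s ∈ T → t ∈ T → IntervalIntegrable (φ z) MeasureTheory.volume s t :=
    fun hs ht => ((hφc z hz).mono (ordConnected_Icc.uIcc_subset hs ht)).intervalIntegrable
  have haT : a ∈ T := hs1 ha
  have hbT : b ∈ T := hs2 hb
  have hI1 : ∫ t in (c - τ)..a, φ z t = 0 := by
    refine (intervalIntegral.integral_congr fun t ht => ?_).trans intervalIntegral.integral_zero
    rw [uIcc_of_le ha.1] at ht
    have := hout t ⟨ht.1, ht.2.trans haT.2⟩ fun h => absurd h.1 (not_lt.2 ht.2)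
    simp only [hφ, show max (α (z, t)) 0 = 0 from max_eq_right this, zero_mul]
  have hI2 : ∫ t in b..(c + τ), φ z t = 0 := by
    refine (intervalIntegral.integral_congr fun t ht => ?_).trans intervalIntegral.integral_zero
    rw [uIcc_of_le hb.2] at ht
    have := hout t ⟨hbT.1.trans ht.1, ht.2⟩ fun h => absurd h.2 (not_lt.2 ht.1)
    simp only [hφ, show max (α (z, t)) 0 = 0 from max_eq_right this, zero_mul]
  rw [← intervalIntegral.integral_add_adjacent_intervals (hφi hlT haT) (hφi haT hrT),
    ← intervalIntegral.integral_add_adjacent_intervals (hφi haT hbT) (hφi hbT hrT), hI1, hI2,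
    zero_add, add_zero] at hzL
  rw [← hzL]
  refine intervalIntegral.integral_congr fun t ht => ?_
  rw [uIcc_of_le hab] at ht
  have : 0 ≤ g t := by
    rcases ht.1.eq_or_lt with h | h
    · rw [← h]; exact hga.ge
    rcases ht.2.eq_or_lt with h' | h'
    · rw [h']; exact hgb.ge
    · exact (hpos t ⟨h, h'⟩).le
  simp only [hφ, show max (α (z, t)) 0 = α (z, t) from max_eq_left this, hg]

/-! ### Construction of the free boundary solution -/

theorem contDiffOn_one_Icc {f f' : ℝ → ℝ} {a b : ℝ} (hab : a < b)
    (hf : ∀ x ∈ Icc a b, HasDerivWithinAt f (f' x) (Icc a b) x)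
    (hc : ContinuousOn f' (Icc a b)) : ContDiffOn ℝ 1 f (Icc a b) := by
  have hu := uniqueDiffOn_Icc hab
  rw [contDiffOn_one_iff_derivWithin hu]
  refine ⟨fun x hx => (hf x hx).differentiableWithinAt, hc.congr fun x hx => ?_⟩
  exact (hf x hx).derivWithin (hu x hx)

theorem antitoneOn_Icc_of_hasDerivWithinAt {f f' : ℝ → ℝ} {a b : ℝ}
    (hf : ∀ x ∈ Icc a b, HasDerivWithinAt f (f' x) (Icc a b) x)
    (h : ∀ x ∈ Icc a b, f' x ≤ 0) : AntitoneOn f (Icc a b) := by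
  have := monotoneOn_Icc_of_hasDerivWithinAt (f := fun x => -f x) (f' := fun x => -f' x)
    (fun x hx => (hf x hx).neg) fun x hx => neg_nonneg.2 (h x hx)
  exact fun x hx y hy hxy => neg_le_neg_iff.1 (this hx hy hxy)

noncomputable section

/-- Damping coefficient of the reduced equation. -/
def Params.damp (P : Params) (y : ℝ × ℝ) : ℝ :=
  2 / P.σ ^ 2 * (P.mM + P.gap * (P.R * (y.1 - P.qM) ^ 2 + y.2)) /
    ((1 - y.1) * (y.1 * (1 - y.1) - y.2))

/-- Weight of the excess in the round trip cost. -/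
def weight (y : ℝ × ℝ) : ℝ := 1 / (y.1 * (1 - y.1) * (y.1 * (1 - y.1) - y.2))

/-- The region in which the free boundary problem is solved. -/
structure Params.Good (P : Params) (y : ℝ × ℝ) : Prop where
  pos : 0 < P.qM → 0 < y.1
  lt_one : P.qM < 1 → y.1 < 1
  lt_big : 1 < P.qM → y.1 < 2 * P.qM - 1
  neg : P.qM < 0 → 2 * P.qM < y.1 ∧ y.1 < 0
  weight_pos : 0 < y.1 * (1 - y.1) * (y.1 * (1 - y.1) - y.2)
  rate_pos : 0 < P.mM → 0 < P.mM + P.gap * (P.R * (y.1 - P.qM) ^ 2 + y.2)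

namespace Params

variable {P : Params}

/-- Every condition in `Good` is open and holds at `(qM, 0)`, where `y.1 * (1 - y.1) * (y.1 * (1 -
y.1) - y.2)` is `A0²`. -/
theorem Regular.good_mem (hP : P.Regular) : {y | P.Good y} ∈ 𝓝 ((P.qM, 0) : ℝ × ℝ) := by
  have hc : Tendsto (fun y : ℝ × ℝ => y.1) (𝓝 (P.qM, 0)) (𝓝 P.qM) := continuousAt_fst
  have h1 : ∀ᶠ y : ℝ × ℝ in 𝓝 (P.qM, 0), 0 < P.qM → 0 < y.1 :=
    eventually_imp_distrib_left.2 fun h => hc.eventually (lt_mem_nhds h)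
  have h2 : ∀ᶠ y : ℝ × ℝ in 𝓝 (P.qM, 0), P.qM < 1 → y.1 < 1 :=
    eventually_imp_distrib_left.2 fun h => hc.eventually (gt_mem_nhds h)
  have h3 : ∀ᶠ y : ℝ × ℝ in 𝓝 (P.qM, 0), 1 < P.qM → y.1 < 2 * P.qM - 1 :=
    eventually_imp_distrib_left.2 fun h => hc.eventually (gt_mem_nhds (by linarith))
  have h4 : ∀ᶠ y : ℝ × ℝ in 𝓝 (P.qM, 0), P.qM < 0 → 2 * P.qM < y.1 ∧ y.1 < 0 :=
    eventually_imp_distrib_left.2 fun h =>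
      (hc.eventually (lt_mem_nhds (by linarith))).and (hc.eventually (gt_mem_nhds h))
  have h5 : ∀ᶠ y : ℝ × ℝ in 𝓝 (P.qM, 0), 0 < y.1 * (1 - y.1) * (y.1 * (1 - y.1) - y.2) := by
    have hcont : ContinuousAt (fun y : ℝ × ℝ => y.1 * (1 - y.1) * (y.1 * (1 - y.1) - y.2))
        (P.qM, 0) := by fun_prop
    refine hcont.eventually (lt_mem_nhds ?_)
    have := hP.A0_ne
    simp only [sub_zero]
    exact mul_self_pos.2 this
  have h6 : ∀ᶠ y : ℝ × ℝ in 𝓝 (P.qM, 0),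
      0 < P.mM → 0 < P.mM + P.gap * (P.R * (y.1 - P.qM) ^ 2 + y.2) :=
    eventually_imp_distrib_left.2 fun h => by
      have hcont : ContinuousAt (fun y : ℝ × ℝ =>
          P.mM + P.gap * (P.R * (y.1 - P.qM) ^ 2 + y.2)) (P.qM, 0) := by fun_prop
      refine hcont.eventually (lt_mem_nhds ?_)
      simpa using h
  filter_upwards [h1, h2, h3, h4, h5, h6] with y h1 h2 h3 h4 h5 h6
  exact ⟨h1, h2, h3, h4, h5, h6⟩

theorem Good.ne {y : ℝ × ℝ} (h : P.Good y) :
    y.1 ≠ 0 ∧ 1 - y.1 ≠ 0 ∧ y.1 * (1 - y.1) - y.2 ≠ 0 := by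
  have h1 := h.weight_pos.ne'
  exact ⟨left_ne_zero_of_mul (left_ne_zero_of_mul h1),
    right_ne_zero_of_mul (left_ne_zero_of_mul h1), right_ne_zero_of_mul h1⟩

theorem continuousOn_damp : ContinuousOn P.damp {y | P.Good y} := by
  unfold damp
  refine ContinuousOn.div (by fun_prop) (by fun_prop) fun y hy => ?_
  exact mul_ne_zero hy.ne.2.1 hy.ne.2.2

theorem continuousOn_weight : ContinuousOn weight {y | P.Good y} := by
  unfold weight
  exact ContinuousOn.div (by fun_prop) (by fun_prop) fun y hy => hy.weight_pos.ne'

theorem Regular.contDiffAt_damp (hP : P.Regular) : ContDiffAt ℝ 1 P.damp (P.qM, 0) := by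
  unfold damp
  refine ContDiffAt.div (by fun_prop) (by fun_prop) ?_
  have h1 := sub_ne_zero.2 hP.qM_ne_one.symm
  simp only [sub_zero]
  exact mul_ne_zero h1 hP.A0_ne

/-- Existence for the reduced problem with all small round trip costs. -/
theorem Regular.exists_excess (hP : P.Regular) : ∃ L₀ > 0, ∀ L, 0 < L → L < L₀ →
    ∃ (a b : ℝ) (g : ℝ → ℝ), a < P.qM ∧ P.qM < b ∧ (∀ t ∈ Icc a b, P.Good (t, g t)) ∧
      (∀ t ∈ Icc a b, HasDerivWithinAt g
        (-(2 * P.R * (t - P.qM)) - g t * P.damp (t, g t)) (Icc a b) t) ∧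
      g a = 0 ∧ g b = 0 ∧ (∀ t ∈ Ioo a b, 0 < g t) ∧
      ∫ t in a..b, g t * weight (t, g t) = L :=
  exists_excursion hP.R_pos hP.contDiffAt_damp hP.good_mem continuousOn_damp continuousOn_weight
    fun _ hy => one_div_pos.2 hy.weight_pos

end Params

theorem m_sub_rate {P : Params} (hP : P.Regular) (g : ℝ → ℝ) (q : ℝ) :
    P.m q - P.rate g q = -(P.gap * g q) := by
  rw [Params.m_eq hP.σ_pos.ne' hP.R_pos.ne', Params.rate]; ring

theorem ell_sub_rate {P : Params} (hP : P.Regular) (g : ℝ → ℝ) (q : ℝ) :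
    P.ell q - P.rate g q = P.gap * (q * (1 - q) - g q) := by
  have h1 := P.ell_sub_m q
  have h2 := m_sub_rate hP g q
  linear_combination h1 + h2

section Construction

variable {P : Params} {a b : ℝ} {g : ℝ → ℝ}

theorem Params.Good.pos_mul {y : ℝ × ℝ} (h : P.Good y) (hP : P.Regular) : 0 < P.qM * y.1 := by
  rcases lt_or_gt_of_ne hP.qM_ne_zero with h0 | h0
  · exact mul_pos_of_neg_of_neg h0 (h.neg h0).2
  · exact mul_pos h0 (h.pos h0)

/-- A solution of the reduced problem gives a solution of the free boundary problem. -/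
theorem freeBoundary_rate (hP : P.Regular) (hsign : 0 < P.gap * (1 - P.R))
    (hm : 0 < P.mM ∨ P.mM = 0 ∧ 0 < P.gap) (ha : a < P.qM) (hb : P.qM < b)
    (hgood : ∀ t ∈ Icc a b, P.Good (t, g t))
    (hg : ∀ t ∈ Icc a b, HasDerivWithinAt g
        (-(2 * P.R * (t - P.qM)) - g t * P.damp (t, g t)) (Icc a b) t)
    (hga : g a = 0) (hgb : g b = 0) (hpos : ∀ t ∈ Ioo a b, 0 < g t) {ξ : ℝ} (hξ : 0 < ξ)
    (hint : ∫ t in a..b, g t * weight (t, g t) = Real.log ξ) :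
    FreeBoundary P ξ a b (P.rate g) := by
  have hab : a < b := ha.trans hb
  have haI : a ∈ Icc a b := left_mem_Icc.2 hab.le
  have hbI : b ∈ Icc a b := right_mem_Icc.2 hab.le
  have hu := uniqueDiffOn_Icc hab
  have hgap := hP.gap_ne
  have hσ := hP.σ_pos.ne'
  have hg0 : ∀ t ∈ Icc a b, 0 ≤ g t := by
    intro t ht
    rcases ht.1.eq_or_lt with h | h
    · rw [← h, hga]
    rcases ht.2.eq_or_lt with h' | h'
    · rw [h', hgb]
    · exact (hpos t ⟨h, h'⟩).le
  have hgc : ContinuousOn g (Icc a b) := fun t ht => (hg t ht).continuousWithinAt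
  have hd : ∀ t ∈ Icc a b, HasDerivWithinAt (P.rate g) (-(P.gap * (g t * P.damp (t, g t))))
      (Icc a b) t := fun t ht => by
    have h1 := (((hasDerivAt_id t).sub_const P.qM).pow 2).const_mul P.R
    refine (((h1.hasDerivWithinAt.add (hg t ht)).const_mul P.gap).const_add P.mM).congr_deriv ?_
    simp
    ring
  have hdc : ContinuousOn (fun t => -(P.gap * (g t * P.damp (t, g t)))) (Icc a b) :=
    (continuousOn_const.mul (hgc.mul (Params.continuousOn_damp.comp
      (continuousOn_id.prodMk hgc) hgood))).neg
  have hdw : ∀ t ∈ Icc a b, derivWithin (P.rate g) (Icc a b) t =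
      -(P.gap * (g t * P.damp (t, g t))) := fun t ht => (hd t ht).derivWithin (hu t ht)
  -- When `mM = 0` the rate is `gap (R (t - qM)² + g t)`. The square is positive off `qM`, and `qM`
  -- is interior to the excursion, where `g > 0`.
  have hrate : ∀ t ∈ Icc a b, 0 < P.rate g t := by
    intro t ht
    rcases hm with h | ⟨h, h'⟩
    · exact (hgood t ht).rate_pos h
    · have hR := hP.R_pos
      have h2 := hg0 t ht
      rw [Params.rate, h, zero_add]
      refine mul_pos h' ?_
      by_cases htq : t = P.qM
      · have := hpos t (by rw [htq]; exact ⟨ha, hb⟩)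
        positivity
      · have : 0 < (t - P.qM) ^ 2 := by
          have := sub_ne_zero.2 htq
          positivity
        positivity
  have hdamp : ∀ t ∈ Icc a b, P.damp (t, g t) =
      2 / P.σ ^ 2 * P.rate g t * t * weight (t, g t) := fun t ht => by
    obtain ⟨h1, h2, h3⟩ := (hgood t ht).ne
    simp only [Params.damp, weight, Params.rate] at *
    field_simp
  have hfac : ∀ t ∈ Icc a b, 0 ≤ 2 / P.σ ^ 2 * P.rate g t * weight (t, g t) * g t :=
    fun t ht => by
      have h1 := hrate t ht
      have h2 := hg0 t ht
      have h3 : 0 < weight (t, g t) := one_div_pos.2 (hgood t ht).weight_pos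
      positivity
  -- The constructed interval avoids `1`, because `Good` keeps `t(1-t)` from vanishing; the
  -- condition at `1` is vacuous.
  have h1n : ∀ t ∈ Icc a b, t ≠ 1 := fun t ht h => (hgood t ht).ne.2.1 (by simp [h])
  refine ⟨fun h h' => ⟨(hgood a haI).pos h, ha, hb, (hgood b hbI).lt_one h'⟩,
    fun h => absurd h hP.qM_ne_one,
    fun h => ⟨(hgood a haI).pos (by linarith), ha, hb, (hgood b hbI).lt_big h⟩,
    fun h => ⟨((hgood a haI).neg h).1, ha, hb, ((hgood b hbI).neg h).2⟩,
    contDiffOn_one_Icc hab hd hdc, hrate, ?_, ?_, ?_, ?_, ?_, ?_, ?_, ?_, ?_, ?_⟩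
  · intro t ht _ h
    have h1 := ell_sub_rate hP g t
    rw [h, sub_self] at h1
    exact mul_ne_zero hgap (hgood t ht).ne.2.2 h1.symm
  · intro h
    refine antitoneOn_Icc_of_hasDerivWithinAt hd fun t ht => ?_
    -- The product of the positive numbers `gap (1 - R)`, `(1 - R) qM` and `qM t` is `gap t` times a
    -- square.
    have h1 : 0 < P.gap * t := by
      have h2 := mul_pos (mul_pos hsign h) ((hgood t ht).pos_mul hP)
      have h3 : 0 < ((1 - P.R) * P.qM) ^ 2 * (P.gap * t) := by
        refine h2.trans_eq ?_; ring
      exact pos_of_mul_pos_right h3 (sq_nonneg _)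
    have h2 := mul_nonneg h1.le (hfac t ht)
    rw [hdamp t ht]
    nlinarith
  · intro h
    refine monotoneOn_Icc_of_hasDerivWithinAt hd fun t ht => ?_
    have h1 : 0 < P.gap * -t := by
      have h2 := mul_pos (mul_pos hsign (neg_pos.2 h)) ((hgood t ht).pos_mul hP)
      have h3 : 0 < ((1 - P.R) * P.qM) ^ 2 * (P.gap * -t) := by
        refine h2.trans_eq ?_; ring
      exact pos_of_mul_pos_right h3 (sq_nonneg _)
    have h2 := mul_nonneg h1.le (hfac t ht)
    rw [hdamp t ht]
    nlinarith
  · intro t ht _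
    have hS : (1 - P.S) / P.S = P.gap * (2 / P.σ ^ 2) := by
      simp only [Params.gap]; field_simp
    obtain ⟨h1, h2, h3⟩ := (hgood t ht).ne
    rw [hdw t ht, hdamp t ht, m_sub_rate hP, ell_sub_rate hP, hS, weight]
    dsimp only at *
    generalize t * (1 - t) - g t = f at *
    field_simp
  · have := m_sub_rate hP g a
    rw [hga] at this; linarith
  · have := m_sub_rate hP g b
    rw [hgb] at this; linarith
  · rw [hdw a haI, hga]; ring
  · rw [hdw b hbI, hgb]; ring
  · exact fun h => absurd rfl (h1n 1 h)
  · rw [← Real.exp_log hξ, ← hint]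
    congr 1
    refine intervalIntegral.integral_congr fun t ht => ?_
    rw [uIcc_of_le hab.le] at ht
    obtain ⟨h1, h2, h3⟩ := (hgood t ht).ne
    simp only [m_sub_rate hP, ell_sub_rate hP, weight] at *
    generalize t * (1 - t) - g t = f at *
    field_simp

/-- The point is the preimage of `q` under `τ_c`. With `c = γu` and `c = 1/γd` it is the lower and
upper real boundary, where this slope must match that of the shadow fraction. -/
theorem deriv_mobius {c q : ℝ} (hc : c ≠ 0) (hq : c + (1 - c) * q ≠ 0) :
    deriv (mobius c) (q / (c + (1 - c) * q)) = (c + (1 - c) * q) ^ 2 / c := by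
  have h1 : 1 + (c - 1) * (q / (c + (1 - c) * q)) = c / (c + (1 - c) * q) := by
    rw [eq_div_iff hq, add_mul, mul_assoc, div_mul_cancel₀ _ hq]; ring
  have h2 : 1 + (c - 1) * (q / (c + (1 - c) * q)) ≠ 0 := by
    rw [h1]; exact div_ne_zero hc hq
  set p := q / (c + (1 - c) * q)
  have h3 : HasDerivAt (mobius c) ((c * 1 * (1 + (c - 1) * p) - c * p * ((c - 1) * 1)) /
      (1 + (c - 1) * p) ^ 2) p :=
    ((hasDerivAt_id p).const_mul c).div (((hasDerivAt_id p).const_mul (c - 1)).const_add 1) h2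
  rw [h3.deriv, show c * 1 * (1 + (c - 1) * p) - c * p * ((c - 1) * 1) = c by ring, h1]
  field_simp

end Construction

end

/-! ### Construction of the shadow price and the shadow fraction -/

noncomputable section

section Construction

variable {P : Params} {a b : ℝ} {G : ℝ → ℝ}

/-- Relative shadow price with logarithmic derivative `-G` on `[a, b]`, extended by constants. -/
def shadowPrice (γu : ℝ) {a b : ℝ} (hab : a ≤ b) (G : ℝ → ℝ) (q : ℝ) : ℝ :=
  γu * Real.exp (-∫ t in a..q, IccExtend hab ((Icc a b).domRestrict G) t)

theorem hasDerivAt_shadowPrice (γu : ℝ) (hab : a ≤ b) (hG : ContinuousOn G (Icc a b)) (q : ℝ) :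
    HasDerivAt (shadowPrice γu hab G)
      (-(shadowPrice γu hab G q * IccExtend hab ((Icc a b).domRestrict G) q)) q := by
  have hc : Continuous (IccExtend hab ((Icc a b).domRestrict G)) :=
    (continuousOn_iff_continuous_domRestrict.1 hG).Icc_extend'
  refine (((intervalIntegral.integral_hasDerivAt_right (hc.intervalIntegrable a q)
    (hc.stronglyMeasurableAtFilter _ _) hc.continuousAt).neg.exp).const_mul γu).congr_deriv ?_
  simp only [shadowPrice, Pi.neg_apply]; ring

/-- As `G` vanishes at `a` and `b`, its constant extension is zero outside and `∫ G` stays in `[0,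
log (γu γd)]`. The bounds hold for every real `q`, as needed for inversion on an open neighbourhood
of `[a, b]`. -/
theorem shadowPrice_mem {γu γd : ℝ} (hu : 0 < γu) (hd : 0 < γd) (hab : a ≤ b)
    (hG : ContinuousOn G (Icc a b)) (h0 : ∀ t ∈ Icc a b, 0 ≤ G t) (ha : G a = 0) (hb : G b = 0)
    (hint : ∫ t in a..b, G t = Real.log (γu * γd)) :
    shadowPrice γu hab G a = γu ∧ shadowPrice γu hab G b = 1 / γd ∧
      ∀ q, shadowPrice γu hab G q ∈ Icc (1 / γd) γu := by
  set Gx := IccExtend hab ((Icc a b).domRestrict G) with hGx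
  have hc : Continuous Gx := (continuousOn_iff_continuous_domRestrict.1 hG).Icc_extend'
  have hGx0 : ∀ t, 0 ≤ Gx t := fun t => h0 _ (projIcc a b hab t).2
  have hGxl : ∀ t ≤ a, Gx t = 0 := fun t ht => by
    rw [hGx, IccExtend_of_le_left _ _ ht]; exact ha
  have hGxr : ∀ t, b ≤ t → Gx t = 0 := fun t ht => by
    rw [hGx, IccExtend_of_right_le _ _ ht]; exact hb
  have hI : ∫ t in a..b, Gx t = Real.log (γu * γd) := by
    rw [← hint]
    refine intervalIntegral.integral_congr fun t ht => ?_
    rw [uIcc_of_le hab] at ht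
    exact IccExtend_of_mem _ _ ht
  have hmono : ∀ {p q : ℝ}, p ≤ q → ∫ t in a..p, Gx t ≤ ∫ t in a..q, Gx t := fun {p q} hpq => by
    rw [← intervalIntegral.integral_add_adjacent_intervals (hc.intervalIntegrable a p)
      (hc.intervalIntegrable p q)]
    exact le_add_of_nonneg_right (intervalIntegral.integral_nonneg hpq fun t _ => hGx0 t)
  have hlow : ∀ q, 0 ≤ ∫ t in a..q, Gx t := fun q => by
    rcases le_total a q with h | h
    · exact intervalIntegral.integral_nonneg h fun t _ => hGx0 t
    · refine ((intervalIntegral.integral_congr fun t ht => ?_).trans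
        intervalIntegral.integral_zero).ge
      rw [uIcc_of_ge h] at ht
      exact hGxl t ht.2
  have hhigh : ∀ q, ∫ t in a..q, Gx t ≤ Real.log (γu * γd) := fun q => by
    rw [← hI]
    rcases le_total q b with h | h
    · exact hmono h
    · rw [← intervalIntegral.integral_add_adjacent_intervals (hc.intervalIntegrable a b)
        (hc.intervalIntegrable b q)]
      refine le_of_eq ?_
      rw [add_eq_left]
      refine (intervalIntegral.integral_congr fun t ht => ?_).trans intervalIntegral.integral_zero
      rw [uIcc_of_le h] at ht
      exact hGxr t ht.1
  have hexp : γu * Real.exp (-Real.log (γu * γd)) = 1 / γd := by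
    rw [Real.exp_neg, Real.exp_log (by positivity)]; field_simp
  refine ⟨by simp [shadowPrice], ?_, fun q => ⟨?_, ?_⟩⟩
  · rw [shadowPrice, ← hGx, hI, hexp]
  · rw [← hexp, shadowPrice, ← hGx]
    have := hhigh q
    gcongr
  · rw [shadowPrice, ← hGx]
    refine mul_le_of_le_one_right hu.le (Real.exp_le_one_iff.2 ?_)
    have := hlow q
    linarith

/-- The fraction of wealth for the shadow fraction `q` and the relative shadow price `κ`. -/
def realFrac (κ : ℝ → ℝ) (q : ℝ) : ℝ := q / (κ q + (1 - κ q) * q)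

theorem hasDerivAt_realFrac {κ : ℝ → ℝ} {G q : ℝ} (hκ : HasDerivAt κ (-(κ q * G)) q)
    (hden : κ q + (1 - κ q) * q ≠ 0) : HasDerivAt (realFrac κ)
      (κ q * (1 + q * (1 - q) * G) / (κ q + (1 - κ q) * q) ^ 2) q := by
  refine ((hasDerivAt_id q).div (hκ.add ((hκ.const_sub 1).mul (hasDerivAt_id q)))
    hden).congr_deriv ?_
  simp only [id]
  congr 1
  simp
  ring

/-- Inverse function theorem on a compact interval, with derivative. -/
theorem exists_inverse_Icc {f f' : ℝ → ℝ} {a b : ℝ} (hab : a < b) {O : Set ℝ} (hO : IsOpen O)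
    (hOc : Convex ℝ O) (hsub : Icc a b ⊆ O) (hf : ∀ x ∈ O, HasDerivAt f (f' x) x)
    (hc : ContinuousOn f' O) (hpos : ∀ x ∈ O, 0 < f' x) :
    ∃ s : ℝ → ℝ, f a < f b ∧ MapsTo s (Icc (f a) (f b)) (Icc a b) ∧
      (∀ y ∈ Icc (f a) (f b), f (s y) = y) ∧ s (f a) = a ∧ s (f b) = b ∧
      MonotoneOn s (Icc (f a) (f b)) ∧ ContDiffOn ℝ 1 s (Icc (f a) (f b)) ∧
      ∀ y ∈ Icc (f a) (f b), HasDerivWithinAt s (f' (s y))⁻¹ (Icc (f a) (f b)) y := by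
  have hmono : StrictMonoOn f O := by
    refine strictMonoOn_of_deriv_pos hOc (fun x hx => (hf x hx).continuousAt.continuousWithinAt)
      fun x hx => ?_
    rw [hO.interior_eq] at hx
    rw [(hf x hx).deriv]; exact hpos x hx
  have haI : a ∈ Icc a b := left_mem_Icc.2 hab.le
  have hbI : b ∈ Icc a b := right_mem_Icc.2 hab.le
  have hfab : f a < f b := hmono (hsub haI) (hsub hbI) hab
  set s := Function.invFunOn f O with hs
  have hleft : ∀ x ∈ O, s (f x) = x := fun x hx => hmono.injOn.leftInvOn_invFunOn hx
  have hcont : ContinuousOn f (Icc a b) := fun x hx =>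
    (hf x (hsub hx)).continuousAt.continuousWithinAt
  have hsurj : ∀ y ∈ Icc (f a) (f b), ∃ x ∈ Icc a b, f x = y := fun y hy =>
    intermediate_value_Icc hab.le hcont hy
  have hmaps : MapsTo s (Icc (f a) (f b)) (Icc a b) := fun y hy => by
    obtain ⟨x, hx, rfl⟩ := hsurj y hy
    rwa [hleft x (hsub hx)]
  have hright : ∀ y ∈ Icc (f a) (f b), f (s y) = y := fun y hy => by
    obtain ⟨x, hx, rfl⟩ := hsurj y hy
    rw [hleft x (hsub hx)]
  have hder : ∀ y ∈ Icc (f a) (f b), HasDerivAt s (f' (s y))⁻¹ y := fun y hy => by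
    have hx := hsub (hmaps hy)
    -- The open set `O` around `[a, b]` makes the inverse function theorem applicable at the end
    -- points too.
    have h1 : HasStrictDerivAt f (f' (s y)) (s y) :=
      hasStrictDerivAt_of_hasDerivAt_of_continuousAt
        (eventually_of_mem (hO.mem_nhds hx) hf) (hc.continuousAt (hO.mem_nhds hx))
    have h2 := h1.to_local_left_inverse (hpos _ hx).ne' (g := s)
      (eventually_of_mem (hO.mem_nhds hx) hleft)
    rw [hright y hy] at h2
    exact h2.hasDerivAt
  have hscont : ContinuousOn s (Icc (f a) (f b)) := fun y hy =>
    (hder y hy).continuousAt.continuousWithinAt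
  refine ⟨s, hfab, hmaps, hright, hleft a (hsub haI), hleft b (hsub hbI), ?_, ?_,
    fun y hy => (hder y hy).hasDerivWithinAt⟩
  · intro y hy z hz hyz
    by_contra hlt
    have := hmono (hsub (hmaps hz)) (hsub (hmaps hy)) (not_le.1 hlt)
    rw [hright y hy, hright z hz] at this
    exact absurd hyz (not_le.2 this)
  · refine contDiffOn_one_Icc hfab (fun y hy => (hder y hy).hasDerivWithinAt) ?_
    exact ((hc.mono hsub).comp hscont hmaps).inv₀ fun y hy => (hpos _ (hsub (hmaps hy))).ne'

end Construction

/-- Shadow data exist for all small transaction costs. -/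
theorem exists_solves {P : Params} (hP : P.Regular) (hsign : 0 < P.gap * (1 - P.R))
    (hm : 0 < P.mM ∨ P.mM = 0 ∧ 0 < P.gap) : ∃ ε₀ > 0, ∀ εu εd : ℝ, 0 < εu → εu < ε₀ → 0 < εd →
      εd < ε₀ → ∃ D : ShadowData, D.Solves P (1 + εu) (1 + εd) := by
  obtain ⟨L₀, hL₀, hex⟩ := hP.exists_excess
  -- The first bound gives `log ξ ≤ εu + εd < L₀`. The second gives `|κ - 1| ≤ 1 / (2|qM| + 4)`; as
  -- `|1 - q| ≤ 2|qM| + 3` within distance `1` of `[a, b]`, the denominator `κ + (1 - κ) q = 1 + (κ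
  -- - 1)(1 - q)` is positive there.
  refine ⟨min (L₀ / 2) (1 / (2 * |P.qM| + 4)), by positivity, ?_⟩
  intro εu εd hu0 hu1 hd0 hd1
  have hu2 := hu1.trans_le (min_le_right _ _)
  have hd2 := hd1.trans_le (min_le_right _ _)
  have hγu : 0 < 1 + εu := by linarith
  have hγd : 0 < 1 + εd := by linarith
  have hL : 0 < Real.log ((1 + εu) * (1 + εd)) := Real.log_pos (by nlinarith)
  have hL' : Real.log ((1 + εu) * (1 + εd)) < L₀ := by
    rw [Real.log_mul hγu.ne' hγd.ne']
    have h1 := Real.log_le_sub_one_of_pos hγu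
    have h2 := Real.log_le_sub_one_of_pos hγd
    have h3 := hu1.trans_le (min_le_left _ _)
    have h4 := hd1.trans_le (min_le_left _ _)
    linarith
  obtain ⟨a, b, g, ha, hb, hgood, hg, hga, hgb, hpos, hint⟩ := hex _ hL hL'
  have hab : a < b := ha.trans hb
  have haI : a ∈ Icc a b := left_mem_Icc.2 hab.le
  have hbI : b ∈ Icc a b := right_mem_Icc.2 hab.le
  have hFB := freeBoundary_rate hP hsign hm ha hb hgood hg hga hgb hpos
    (mul_pos hγu hγd) hint
  have hgap := hP.gap_ne
  set G : ℝ → ℝ := fun t => g t * weight (t, g t) with hG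
  have hgc : ContinuousOn g (Icc a b) := fun t ht => (hg t ht).continuousWithinAt
  have hGc : ContinuousOn G (Icc a b) := hgc.mul (Params.continuousOn_weight.comp
    (continuousOn_id.prodMk hgc) hgood)
  have hw : ∀ t ∈ Icc a b, 0 < weight (t, g t) := fun t ht =>
    one_div_pos.2 (hgood t ht).weight_pos
  have hG0 : ∀ t ∈ Icc a b, 0 ≤ G t := by
    intro t ht
    refine mul_nonneg ?_ (hw t ht).le
    rcases ht.1.eq_or_lt with h | h
    · rw [← h, hga]
    rcases ht.2.eq_or_lt with h' | h'
    · rw [h', hgb]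
    · exact (hpos t ⟨h, h'⟩).le
  have hGa : G a = 0 := by simp [hG, hga]
  have hGb : G b = 0 := by simp [hG, hgb]
  set κ := shadowPrice (1 + εu) hab.le G with hκ
  obtain ⟨hκa, hκb, hκm⟩ := shadowPrice_mem hγu hγd hab.le hGc hG0 hGa hGb hint
  rw [← hκ] at hκa hκb hκm
  set Gx := IccExtend hab.le ((Icc a b).domRestrict G) with hGx
  have hGxc : Continuous Gx := (continuousOn_iff_continuous_domRestrict.1 hGc).Icc_extend'
  have hGxG : ∀ t ∈ Icc a b, Gx t = G t := fun t ht => IccExtend_of_mem _ _ ht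
  have hκd : ∀ q, HasDerivAt κ (-(κ q * Gx q)) q := hasDerivAt_shadowPrice (1 + εu) hab.le hGc
  have hκc : Continuous κ := continuous_iff_continuousAt.2 fun q => (hκd q).continuousAt
  have hκ0 : ∀ q, 0 < κ q := fun q => lt_of_lt_of_le (by positivity) (hκm q).1
  have hu := uniqueDiffOn_Icc hab
  have hκdw : ∀ q ∈ Icc a b, HasDerivWithinAt κ (-(κ q * G q)) (Icc a b) q := fun q hq => by
    rw [← hGxG q hq]; exact (hκd q).hasDerivWithinAt
  have hGode : ∀ q ∈ Icc a b, -(κ q * G q) =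
      κ q / (q * (1 - q)) * ((P.m q - P.rate g q) / (P.ell q - P.rate g q)) := fun q hq => by
    obtain ⟨h1, h2, h3⟩ := (hgood q hq).ne
    rw [m_sub_rate hP, ell_sub_rate hP]
    simp only [hG, weight] at *
    generalize q * (1 - q) - g q = f at *
    field_simp
  -- the fraction of wealth as a function of the shadow fraction
  set O := Ioo (a - 1) (b + 1) with hO
  have hsub : Icc a b ⊆ O := fun q hq => ⟨by linarith [hq.1], by linarith [hq.2]⟩
  have hden : ∀ q ∈ O, 0 < κ q + (1 - κ q) * q := by
    intro q hq
    have h1 := abs_le.1 (hFB.abs_le hP haI)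
    have h2 := abs_le.1 (hFB.abs_le hP hbI)
    have h3 : |1 - q| ≤ 2 * |P.qM| + 3 := by
      rw [abs_le]; constructor <;> linarith [hq.1, hq.2]
    have h4 : |κ q - 1| ≤ 1 / (2 * |P.qM| + 4) := by
      obtain ⟨h5, h6⟩ := hκm q
      have h7 : 1 - εd ≤ 1 / (1 + εd) := by
        rw [le_div_iff₀ hγd]; nlinarith
      rw [abs_le]; constructor <;> linarith
    have h5 : |(κ q - 1) * (1 - q)| < 1 := by
      rw [abs_mul]
      calc |κ q - 1| * |1 - q| ≤ 1 / (2 * |P.qM| + 4) * (2 * |P.qM| + 3) := by gcongr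
        _ < 1 := by
          rw [one_div, inv_mul_lt_iff₀ (by positivity)]; linarith
    have h6 := (abs_lt.1 h5).1
    linarith
  -- This factor carries the sign of the derivative of `realFrac κ`. On `[a, b]` it equals
  -- `(q(1-q))²` times the positive weight, outside it is `1`.
  have hfac : ∀ q, 0 < 1 + q * (1 - q) * Gx q := by
    intro q
    by_cases hq : q ∈ Icc a b
    · obtain ⟨h1, h2, h3⟩ := (hgood q hq).ne
      have h4 : 1 + q * (1 - q) * Gx q =
          (q * (1 - q)) ^ 2 * weight (q, g q) := by
        rw [hGxG q hq]
        simp only [hG, weight] at *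
        have h5 : q * (1 - q) * (q * (1 - q) - g q) ≠ 0 := mul_ne_zero (mul_ne_zero h1 h2) h3
        field_simp
        ring
      rw [h4]
      have := hw q hq
      have := mul_ne_zero h1 h2
      positivity
    · have h1 : Gx q = 0 := by
        rcases lt_or_ge q a with h | h
        · rw [hGx, IccExtend_of_le_left _ _ h.le]; exact hGa
        · have h2 : b ≤ q := by
            by_contra h3
            exact hq ⟨h, (not_le.1 h3).le⟩
          rw [hGx, IccExtend_of_right_le _ _ h2]; exact hGb
      rw [h1]; norm_num
  obtain ⟨s, hlt, hmaps, hright, hsa, hsb, hsmono, hsC, hsd⟩ := exists_inverse_Icc hab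
    (f := realFrac κ)
    (f' := fun q => κ q * (1 + q * (1 - q) * Gx q) / (κ q + (1 - κ q) * q) ^ 2)
    isOpen_Ioo (convex_Ioo _ _) hsub
    (fun q hq => hasDerivAt_realFrac (hκd q) (hden q hq).ne')
    (ContinuousOn.div (by fun_prop) (by fun_prop) fun q hq => (pow_pos (hden q hq) 2).ne')
    (fun q hq => div_pos (mul_pos (hκ0 q) (hfac q)) (pow_pos (hden q hq) 2))
  have hdena := hden a (hsub haI)
  have hdenb := hden b (hsub hbI)
  rw [hκa] at hdena
  rw [hκb] at hdenb
  have hfa : realFrac κ a = mobius (1 / (1 + εu)) a := by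
    have h1 : 1 + (1 / (1 + εu) - 1) * a = (1 + εu + (1 - (1 + εu)) * a) / (1 + εu) := by
      field_simp
    rw [realFrac, mobius, hκa, h1]
    field_simp
  have hfb : realFrac κ b = mobius (1 + εd) b := by
    have h1 : 1 / (1 + εd) + (1 - 1 / (1 + εd)) * b = (1 + (1 + εd - 1) * b) / (1 + εd) := by
      field_simp
    rw [realFrac, mobius, hκb, h1]
    field_simp
  have huJ := uniqueDiffOn_Icc hlt
  have hlow : ShadowData.pLow ⟨a, b, P.rate g, κ, s⟩ (1 + εu) = realFrac κ a := hfa.symm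
  have hhigh : ShadowData.pHigh ⟨a, b, P.rate g, κ, s⟩ (1 + εd) = realFrac κ b := hfb.symm
  have hlJ : realFrac κ a ∈ Icc (realFrac κ a) (realFrac κ b) := left_mem_Icc.2 hlt.le
  have hrJ : realFrac κ b ∈ Icc (realFrac κ a) (realFrac κ b) := right_mem_Icc.2 hlt.le
  refine ⟨⟨a, b, P.rate g, κ, s⟩, ?_, hFB, ?_, ?_⟩
  · rw [hlow, hhigh]; exact hlt
  · refine ⟨contDiffOn_one_Icc hab hκdw (hκc.continuousOn.mul hGc).neg, fun q _ => hκ0 q,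
      antitoneOn_Icc_of_hasDerivWithinAt hκdw fun q hq =>
        neg_nonpos.2 (mul_nonneg (hκ0 q).le (hG0 q hq)), fun q hq _ => ?_, hκa, hκb, ?_, ?_⟩
    · rw [← hGode q hq]; exact (hκdw q hq).derivWithin (hu q hq)
    · refine ((hκdw a haI).derivWithin (hu a haI)).trans ?_
      rw [hGa, mul_zero, neg_zero]
    · refine ((hκdw b hbI).derivWithin (hu b hbI)).trans ?_
      rw [hGb, mul_zero, neg_zero]
  · rw [hlow, hhigh]
    refine ⟨hsC, hmaps, hsmono, fun p hp hp1 => ?_, hsa, hsb, ?_, ?_, fun h1 => ?_⟩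
    · have hq := hmaps hp
      rw [(hsd p hp).derivWithin (huJ p hp)]
      dsimp only
      rw [ell_sub_rate hP, P.ell_sub_m, mul_div_mul_left _ _ hgap, hGxG _ hq]
      have hpq := hright p hp
      generalize s p = q at *
      obtain ⟨h1, h2, h3⟩ := (hgood q hq).ne
      have hd := (hden q (hsub hq)).ne'
      have hk := (hκ0 q).ne'
      -- With `d = κ + (1 - κ) q`, the inverse has slope `d² / (κ (1 + q(1-q) G))`. Since `p(1-p) =
      -- q(1-q) κ / d²` and `1 + q(1-q) G = q(1-q) / (q(1-q) - g)`, this is `(q(1-q) - g) /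
      -- (p(1-p))`.
      have h4 : p * (1 - p) = q * (1 - q) * κ q / (κ q + (1 - κ q) * q) ^ 2 := by
        have h5 : 1 - q / (κ q + (1 - κ q) * q) = κ q * (1 - q) / (κ q + (1 - κ q) * q) := by
          rw [eq_div_iff hd, sub_mul, div_mul_cancel₀ _ hd]; ring
        rw [← hpq, realFrac, h5, div_mul_div_comm]; ring
      have h5 : 1 + q * (1 - q) * G q = q * (1 - q) / (q * (1 - q) - g q) := by
        simp only [hG, weight] at *
        have h5 : q * (1 - q) * (q * (1 - q) - g q) ≠ 0 := mul_ne_zero (mul_ne_zero h1 h2) h3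
        field_simp
        ring
      rw [h4, h5]
      simp only at h1 h2 h3
      generalize q * (1 - q) - g q = f at *
      generalize κ q + (1 - κ q) * q = d at *
      field_simp
    · rw [(hsd _ hlJ).derivWithin (huJ _ hlJ), hsa, hGxG a haI, hGa, hκa]
      have h1 := deriv_mobius hγu.ne' hdena.ne'
      rw [realFrac, hκa, h1]
      simp
    · rw [(hsd _ hrJ).derivWithin (huJ _ hrJ), hsb, hGxG b hbI, hGb, hκb]
      have h1 := deriv_mobius (one_div_pos.2 hγd).ne' hdenb.ne'
      rw [realFrac, hκb, h1]
      simp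
    · have hq := hmaps h1
      have h2 := hright 1 h1
      have hd := hden _ (hsub hq)
      rw [realFrac, div_eq_one_iff_eq hd.ne'] at h2
      have h3 : κ (s 1) * (1 - s 1) = 0 := by linarith
      rcases mul_eq_zero.1 h3 with h | h
      · exact absurd h (hκ0 _).ne'
      · linarith

end

/-! ### Conclusion -/

theorem Params.regular_of_wellPosed {P : Params} (hσ : 0 < P.σ) (hR : 0 < P.R) (hS : 0 < P.S)
    (hwell : (P.R < 1 ∧ P.S < 1 ∧ 0 ≤ P.mM) ∨ (1 < P.R ∧ 1 < P.S ∧ 0 < P.mM))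
    (hq0 : P.qM ≠ 0) (hq1 : P.qM ≠ 1) :
    P.Regular ∧ 0 < P.gap * (1 - P.R) ∧ (0 < P.mM ∨ P.mM = 0 ∧ 0 < P.gap) := by
  have hσ2 : 0 < P.σ ^ 2 / 2 := by positivity
  -- `gap` has the sign of `1 - S`, and `R` and `S` lie on the same side of `1`, so `gap (1 - R) >
  -- 0`. The case `mM = 0` is allowed only when `gap > 0`.
  rcases hwell with ⟨h1, h2, h3⟩ | ⟨h1, h2, h3⟩
  · have hg : 0 < P.gap := mul_pos (div_pos (by linarith) hS) hσ2
    refine ⟨⟨hσ, hR, hS, h1.ne, hg.ne', hq0, hq1⟩, mul_pos hg (by linarith), ?_⟩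
    rcases h3.eq_or_lt with h | h
    · exact Or.inr ⟨h.symm, hg⟩
    · exact Or.inl h
  · have hg : P.gap < 0 := mul_neg_of_neg_of_pos (div_neg_of_neg_of_pos (by linarith) hS) hσ2
    exact ⟨⟨hσ, hR, hS, h1.ne', hg.ne, hq0, hq1⟩, mul_pos_of_neg_of_neg hg (by linarith),
      Or.inl h3⟩

end EpsteinZin

theorem proposition6p3 (P : EpsteinZin.Params)
    (hσ : 0 < P.σ) (hR : 0 < P.R) (hS : 0 < P.S)
    (hwell : (P.R < 1 ∧ P.S < 1 ∧ 0 ≤ P.mM) ∨ (1 < P.R ∧ 1 < P.S ∧ 0 < P.mM))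
    (hq0 : P.qM ≠ 0) (hq1 : P.qM ≠ 1) :
    ∃ ε₀ : ℝ, 0 < ε₀ ∧ ∃ K : ℝ, ∀ εu εd : ℝ, 0 < εu → εu < ε₀ → 0 < εd → εd < ε₀ →
      (∃ D : EpsteinZin.ShadowData, D.Solves P (1 + εu) (1 + εd)) ∧
      ∀ D : EpsteinZin.ShadowData, D.Solves P (1 + εu) (1 + εd) →
      ∀ ε : ℝ, ε = (1 + εu) * (1 + εd) - 1 →
      ∀ t x y φ p : ℝ, 0 ≤ t → EpsteinZin.Solvent (1 + εu) (1 + εd) x y φ →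
        p = EpsteinZin.frac x y φ → p ∈ Set.Icc (D.pLow (1 + εu)) (D.pHigh (1 + εd)) →
        (0 < P.mM →
          |D.consumption t x y φ - P.consumption0 t x y φ *
              (1 + P.R * (1 - P.S) / P.S * (P.σ ^ 2 / (2 * P.mM))
                    * P.Delta ^ (2 / 3 : ℝ) * (εu + εd) ^ (2 / 3 : ℝ)
                + P.qM / (2 * P.S)
                    * (1 - 1 / 2 * EpsteinZin.h3
                        ((p - P.qM) / (P.Delta ^ (1 / 3 : ℝ) * ε ^ (1 / 3 : ℝ)))) * (εu + εd)
                + P.qM / 2 * (εu - εd))|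
            ≤ K * (x + y * φ) * ε ^ (4 / 3 : ℝ)) ∧
        (P.mM = 0 →
          |D.consumption t x y φ - (x + y * φ) * (P.R * (1 - P.S) / P.S * (P.σ ^ 2 / 2)
                    * P.Delta ^ (2 / 3 : ℝ) * (εu + εd) ^ (2 / 3 : ℝ))|
            ≤ K * (x + y * φ) * ε ^ (4 / 3 : ℝ)) := by
  obtain ⟨hP, hsign, hm⟩ := EpsteinZin.Params.regular_of_wellPosed hσ hR hS hwell hq0 hq1
  obtain ⟨ε₁, hε₁, hex⟩ := EpsteinZin.exists_solves hP hsign hm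
  obtain ⟨ε₂, hε₂, K, hK⟩ := EpsteinZin.exists_consumption_expansion hP
  refine ⟨min ε₁ ε₂, lt_min hε₁ hε₂, K, fun εu εd hu hu' hd hd' =>
    ⟨hex εu εd hu (hu'.trans_le (min_le_left _ _)) hd (hd'.trans_le (min_le_left _ _)), ?_⟩⟩
  intro D hD ε hε t x y φ p _ hs hp hpm
  have key := hK εu εd hu (hu'.trans_le (min_le_right _ _)) hd (hd'.trans_le (min_le_right _ _))
    D hD ε hε t x y φ p hs hp hpm
  -- The expansion is not divided by `mM`, so it covers both cases: factoring out `mM > 0` gives the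
  -- first, and for `mM = 0` the terms linear in the costs drop out.
  refine ⟨fun h => ?_, fun h => ?_⟩
  · refine le_of_eq_of_le (congrArg _ ?_) key
    rw [EpsteinZin.Params.consumption0, EpsteinZin.Params.gap]
    have hS' := hS.ne'
    have h' := h.ne'
    field_simp
    ring
  · refine le_of_eq_of_le (congrArg _ ?_) key
    rw [h, EpsteinZin.Params.gap]
    have hS' := hS.ne'
    field_simp
    ring
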